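/- Let $d\ge 1$, $H\in(0,1)$, $T>0$, and let $X=(X^1,\dots,X^d)=\{X_t,\ t\ge 0\}$ be a (jointly measurable) $d$-dimensional process whose components are independent copies of one centered one-dimensional Gaussian process. Assume: (i) (strong local nondeterminism) there is $\kappa>0$ such that for all $m\ge1$ and all times $s_1,\dots,s_m,t\in(0,\infty)$, $$\mathrm{Var}\big(X^1_t\mid X^1_{s_1},\dots,X^1_{s_m}\big)\ \ge\ \kappa\,\min\{|t-s_1|^{2H},\dots,|t-s_m|^{2H},t^{2H}\};$$ (ii) there is $K>0$ such that $\mathbb E(X^1_t-X^1_s)^2\le K|t-s|^{2H}$ for all $t,s\ge0$. Let $\boldsymbol\alpha=(\alpha_1,\dots,\alpha_d)\in[0,\infty)^d$, $|\boldsymbol\alpha|=\sum_{\ell=1}^d\alpha_\ell$. For $\varepsilon>0$ and $x\in\mathbb R^d$ put $$D^{(\boldsymbol\alpha)}_{\pm}p_\varepsilon(x)=\frac1{(2\pi)^d}\int_{\mathbb R^d}\Big(\prod_{\ell=1}^d|y_\ell|^{\alpha_\ell}e^{\pm i\frac{\pi\alpha_\ell}{2}\mathrm{sgn}(y_\ell)}\Big)e^{iy\cdot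 x}e^{-\frac{\varepsilon}{2}|y|^2}\,dy,\qquad L^{(\boldsymbol\alpha)}_{\pm,\varepsilon}(T,x)=\int_0^TD^{(\boldsymbol\alpha)}_{\pm}p_\varepsilon(X_t+x)\,dt.$$ Say that $L^{(\boldsymbol\alpha)}_{\pm,\varepsilon}(T,x)$ diverges in $L^2$ as $\varepsilon\downarrow0$ if these random variables are square integrable, $\mathbb E|L^{(\boldsymbol\alpha)}_{\pm,\varepsilon}(T,x)|^2\to\infty$, and consequently they have no limit in $L^2$ as $\varepsilon\downarrow0$. Assume $H(2|\boldsymbol\alpha|+d)\ge1$. Then, for each of the two signs: (1) if $Hd\le1$, then $L^{(\boldsymbol\alpha)}_{\pm,\varepsilon}(T,0)$ diverges in $L^2$ as $\varepsilon\downarrow0$; (2) if $Hd>1$ and $\sum_{\ell:\,\alpha_\ell\in\mathbb Z}\alpha_\ell$ is even, then $L^{(\boldsymbol\alpha)}_{\pm,\varepsilon}(T,0)$ diverges in $L^2$ as $\varepsilon\downarrow0$; (3) if $Hd>1$, $\sum_{\ell:\,\alpha_\ell\in\mathbb Z}\alpha_\ell$ is odd, and $\mathbb E(X^1_tX^1_s)\ge0$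 for all $t,s\ge0$, then $L^{(\boldsymbol\alpha)}_{\pm,\varepsilon}(T,0)$ diverges in $L^2$ as $\varepsilon\downarrow0$; (4) if $x\in\mathbb R^d$ is such that $\alpha_\ell\in\mathbb Z$ and $x_\ell\neq0$ for some $\ell$, and if there is a nonnegative decreasing function $\beta:(1,\infty)\to\mathbb R$ with $\lim_{\gamma\to\infty}\beta(\gamma)=0$ such that $$\big|\mathbb E[(X^1_t-X^1_s)X^1_s]\big|\le\beta(\gamma)\,\big[\mathbb E(X^1_t-X^1_s)^2\big]^{1/2}\big[\mathbb E(X^1_s)^2\big]^{1/2}$$ for all $0<s<t$ and $\gamma>1$ with $\frac{t-s}{s}\le\frac1\gamma$, then $L^{(\boldsymbol\alpha)}_{\pm,\varepsilon}(T,x)$ diverges in $L^2$ as $\varepsilon\downarrow0$. -/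

import Mathlib

open MeasureTheory ProbabilityTheory Filter Topology
open scoped NNReal ENNReal

noncomputable section

namespace FracLocalTime

/-- Property **SLND** with index `H` of a one-dimensional process `Y` indexed by `[0, ∞)`:
for some `κ > 0`, for every `m ≥ 1` and all times `s₁, …, s_m, t > 0`,
`Var(Y_t | Y_{s₁}, …, Y_{s_m}) ≥ κ min {|t - s₁|^{2H}, …, |t - s_m|^{2H}, t^{2H}}` a.s.
(the index type `Fin (m + 1)` encodes that there is at least one conditioning time). -/
def SLND {Ω : Type*} [MeasurableSpace Ω] (Y : ℝ≥0 → Ω → ℝ) (H : ℝ) (P : Measure Ω) : Prop :=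
  ∃ κ : ℝ, 0 < κ ∧ ∀ (m : ℕ) (s : Fin (m + 1) → ℝ≥0) (t : ℝ≥0), (∀ i, 0 < s i) → 0 < t →
    ∀ᵐ ω ∂P,
      κ * min (⨅ i, |(t : ℝ) - (s i : ℝ)| ^ (2 * H)) ((t : ℝ) ^ (2 * H)) ≤
        (Var[Y t; P | ⨆ i, MeasurableSpace.comap (Y (s i)) inferInstance]) ω

/-- Upper bound on second moments of increments: `E (Y_t - Y_s)² ≤ K |t - s|^{2H}`. -/
def IncrementVarianceBound {Ω : Type*} [MeasurableSpace Ω] (Y : ℝ≥0 → Ω → ℝ) (H : ℝ)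
    (P : Measure Ω) : Prop :=
  ∃ K : ℝ, 0 < K ∧ ∀ t s : ℝ≥0,
    ∫ ω, (Y t ω - Y s ω) ^ 2 ∂P ≤ K * |(t : ℝ) - (s : ℝ)| ^ (2 * H)

/-- Decay of the covariance of increments: there is a nonnegative decreasing
`β : (1, ∞) → ℝ` with `β(γ) → 0` as `γ → ∞`, such that for `0 < s < t` and `γ > 1` with
`(t - s) / s ≤ 1 / γ`,
`|E[(Y_t - Y_s) Y_s]| ≤ β(γ) (E (Y_t - Y_s)²)^{1/2} (E Y_s²)^{1/2}`. -/
def IncrementCovarianceDecay {Ω : Type*} [MeasurableSpace Ω] (Y : ℝ≥0 → Ω → ℝ)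
    (P : Measure Ω) : Prop :=
  ∃ β : ℝ → ℝ, (∀ γ, 1 < γ → 0 ≤ β γ) ∧ AntitoneOn β (Set.Ioi 1) ∧ Tendsto β atTop (𝓝 0) ∧
    ∀ (s t : ℝ≥0) (γ : ℝ), 0 < s → s < t → 1 < γ → ((t : ℝ) - (s : ℝ)) / (s : ℝ) ≤ 1 / γ →
      |∫ ω, (Y t ω - Y s ω) * Y s ω ∂P| ≤
        β γ * Real.sqrt (∫ ω, (Y t ω - Y s ω) ^ 2 ∂P) * Real.sqrt (∫ ω, (Y s ω) ^ 2 ∂P)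

/-- The component `X^ℓ` of a `d`-dimensional process. -/
def component {Ω : Type*} {d : ℕ} (X : ℝ≥0 → Ω → EuclideanSpace ℝ (Fin d)) (ℓ : Fin d) :
    ℝ≥0 → Ω → ℝ :=
  fun t ω => X t ω ℓ

/-- The class `G^{d,H}_S`: the components of `X` are independent copies of one centered
one-dimensional Gaussian process, which has property **SLND** with index `H`.
(As the components have the same law, a condition on each of them is a condition on `X^1`.) -/
structure ClassGS {Ω : Type*} [MeasurableSpace Ω] {d : ℕ}
    (X : ℝ≥0 → Ω → EuclideanSpace ℝ (Fin d)) (H : ℝ) (P : Measure Ω) : Prop where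
  gaussian : ∀ ℓ, IsGaussianProcess (component X ℓ) P
  centered : ∀ ℓ t, ∫ ω, component X ℓ t ω ∂P = 0
  indep : iIndepFun (fun (ℓ : Fin d) (ω : Ω) (t : ℝ≥0) => component X ℓ t ω) P
  identDistrib : ∀ ℓ ℓ' : Fin d,
    IdentDistrib (fun (ω : Ω) (t : ℝ≥0) => component X ℓ t ω)
      (fun (ω : Ω) (t : ℝ≥0) => component X ℓ' t ω) P P
  slnd : ∀ ℓ, SLND (component X ℓ) H P

/-- The class `G^{d,H}_{S,U}`. -/
structure ClassGSU {Ω : Type*} [MeasurableSpace Ω] {d : ℕ}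
    (X : ℝ≥0 → Ω → EuclideanSpace ℝ (Fin d)) (H : ℝ) (P : Measure Ω) : Prop
    extends ClassGS X H P where
  increment_le : ∀ ℓ, IncrementVarianceBound (component X ℓ) H P

/-- The class `G̃^{d,H}_{S,U}`: members of `G^{d,H}_{S,U}` with decaying covariance of
increments. -/
structure ClassGSUTilde {Ω : Type*} [MeasurableSpace Ω] {d : ℕ}
    (X : ℝ≥0 → Ω → EuclideanSpace ℝ (Fin d)) (H : ℝ) (P : Measure Ω) : Prop
    extends ClassGSU X H P where
  decay : ∀ ℓ, IncrementCovarianceDecay (component X ℓ) P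

/-- The class `Ĝ^{d,H}_{S,U}`: members of `G^{d,H}_{S,U}` with nonnegative covariances. -/
structure ClassGSUHat {Ω : Type*} [MeasurableSpace Ω] {d : ℕ}
    (X : ℝ≥0 → Ω → EuclideanSpace ℝ (Fin d)) (H : ℝ) (P : Measure Ω) : Prop
    extends ClassGSU X H P where
  cov_nonneg : ∀ (ℓ : Fin d) (t s : ℝ≥0), 0 ≤ ∫ ω, component X ℓ t ω * component X ℓ s ω ∂P

/-- `|y|^a e^{σ i (π a / 2) sgn y}`; here `σ = 1` is the sign `+` and `σ = -1` the sign `-`. -/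
def fracSymbol (σ a y : ℝ) : ℂ :=
  ((|y| ^ a : ℝ) : ℂ) * Complex.exp (((σ * (Real.pi * a / 2) * Real.sign y : ℝ) : ℂ) * Complex.I)

/-- The fractional partial derivative `D^{(α)}_± p_ε` of the `d`-dimensional heat kernel at `x`:
`(2π)^{-d} ∫ (∏_ℓ |y_ℓ|^{α_ℓ} e^{± i (π α_ℓ / 2) sgn y_ℓ}) e^{i y·x} e^{-ε |y|² / 2} dy`. -/
def fracDerivHeatKernel {d : ℕ} (σ : ℝ) (α : Fin d → ℝ) (ε : ℝ)
    (x : EuclideanSpace ℝ (Fin d)) : ℂ :=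
  (1 / ((2 * Real.pi) ^ d : ℝ) : ℂ) *
    ∫ y : EuclideanSpace ℝ (Fin d),
      (∏ ℓ, fracSymbol σ (α ℓ) (y ℓ)) *
        Complex.exp (Complex.I * ((inner ℝ y x : ℝ) : ℂ)) *
        Complex.exp ((-(ε / 2) * ‖y‖ ^ 2 : ℝ) : ℂ)

/-- The approximation `L^{(α)}_{±,ε}(T, x) = ∫_0^T D^{(α)}_± p_ε (X_t + x) dt`. -/
def approxDeriv {Ω : Type*} {d : ℕ} (X : ℝ≥0 → Ω → EuclideanSpace ℝ (Fin d)) (σ : ℝ)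
    (α : Fin d → ℝ) (T : ℝ) (x : EuclideanSpace ℝ (Fin d)) (ε : ℝ) (ω : Ω) : ℂ :=
  ∫ t in (0 : ℝ)..T, fracDerivHeatKernel σ α ε (X t.toNNReal ω + x)

/-- The family `F ε` of square-integrable random variables diverges in `L²` as `ε ↓ 0`: it has no
limit in `L²`, and in fact its second moment tends to infinity. -/
structure DivergesInL2 {Ω : Type*} [MeasurableSpace Ω] (F : ℝ → Ω → ℂ) (P : Measure Ω) :
    Prop where
  memLp : ∀ ε, 0 < ε → MemLp (F ε) 2 P
  not_converges : ¬ ∃ Y : Ω → ℂ, MemLp Y 2 P ∧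
    Tendsto (fun ε => eLpNorm (fun ω => F ε ω - Y ω) 2 P) (𝓝[>] 0) (𝓝 0)
  tendsto_atTop : Tendsto (fun ε => ∫ ω, ‖F ε ω‖ ^ 2 ∂P) (𝓝[>] 0) atTop

/-- The real number `a` is an integer. -/
def IsInt (a : ℝ) : Prop := ∃ n : ℤ, a = n

open Classical in
/-- `∑_{ℓ : α_ℓ ∈ ℤ} α_ℓ`, as an integer. -/
def integerOrderSum {d : ℕ} (α : Fin d → ℝ) : ℤ :=
  ∑ ℓ with IsInt (α ℓ), ⌊α ℓ⌋

end FracLocalTime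

end

noncomputable section

namespace FracLocalTime

open scoped ComplexConjugate

/-! ### The fractional symbol -/

section Symbol

variable {σ a : ℝ}

/-! Write `Z_t` for the kernel at `X_t + x`. By independence and Fourier inversion, `E[Z_t conj
Z_s]` is a product over coordinates of integrals of `φ(y) conj φ(z) e^{ix(y-z)}` against a Gaussian
with covariance matrix that of `(X_t, X_s)` plus `ε` times the identity
(`integral_fracDerivHeatKernel_mul_conj`). Divergence of the second moment comes from the diagonal
`t = s`, away from the time origin.

Near the diagonal, put `w = y - z` and scale `z` by `δ`, where `δ² = E(X_t - X_s)² + 2ε` in one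
coordinate. A factor `δ^{-(2a+1)}` comes out per coordinate (`integral_quadIntegrand_eq`), leaving
an integral continuous in parameters that range over a compact set, thanks to local nondeterminism.
At `δ = 0` both symbols sit at the same point, so their phases cancel and leave `|u|^{2a}`. The
limit is then positive if `x = 0`, and also for general `x` if the normalized covariance of the
increment with `X_t` vanishes, which decay of the increment covariance guarantees. Compactness makes
this uniform: the covariance is at least `c (|t-s|^{2H} + ε)^{-p}` with `p = |α| + d/2`
(`CovBounds.exists_le_re_prodQuad`). As `2Hp ≥ 1`, its integral across the diagonal diverges, at
least logarithmically.

It remains to keep the off-diagonal terms, of unknown sign, from cancelling this. Splitting the time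
integral into `u` over `(0, T/2]` and `v` over `(T/2, T]`, one has `|u + v|² ≥ Re(v conj(v + 2u))`,
so only `t > T/2` matters and the corner where both times are small never enters. For such `t`, off
the diagonal the covariance is `O((s^{2H} + ε)^{-p'})` with `p' = (|α| + d)/2`
(`CovBounds.exists_norm_prodQuad_le`). If `|α| > 0` then `p' < p` and the diagonal dominates
(`tendsto_powKer_sub`); if `|α| = 0` the kernel is a positive Gaussian density and there is nothing
to cancel. -/

lemma norm_fracSymbol (σ a y : ℝ) : ‖fracSymbol σ a y‖ = |y| ^ a := by
  rw [fracSymbol, norm_mul, Complex.norm_exp_ofReal_mul_I, mul_one, Complex.norm_real,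
    Real.norm_of_nonneg (Real.rpow_nonneg (abs_nonneg y) a)]

lemma fracSymbol_zero_order (σ y : ℝ) : fracSymbol σ 0 y = 1 := by
  simp [fracSymbol]

lemma fracSymbol_mul_of_pos {r : ℝ} (hr : 0 < r) (y : ℝ) :
    fracSymbol σ a (r * y) = ((r ^ a : ℝ) : ℂ) * fracSymbol σ a y := by
  have h : Real.sign (r * y) = Real.sign y := by
    rcases lt_trichotomy y 0 with h | h | h
    · rw [Real.sign_of_neg h, Real.sign_of_neg (mul_neg_of_pos_of_neg hr h)]
    · simp [h]
    · rw [Real.sign_of_pos h, Real.sign_of_pos (mul_pos hr h)]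
  rw [fracSymbol, fracSymbol, h, abs_mul, abs_of_pos hr,
    Real.mul_rpow hr.le (abs_nonneg y), Complex.ofReal_mul, mul_assoc]

lemma fracSymbol_mul_conj (σ a y : ℝ) :
    fracSymbol σ a y * conj (fracSymbol σ a y) = (((|y| ^ a) ^ 2 : ℝ) : ℂ) := by
  rw [Complex.mul_conj, Complex.normSq_eq_norm_sq, norm_fracSymbol]

lemma measurable_sign : Measurable Real.sign := by
  unfold Real.sign
  exact Measurable.ite measurableSet_Iio measurable_const
    (Measurable.ite measurableSet_Ioi measurable_const measurable_const)

lemma measurable_fracSymbol (σ a : ℝ) : Measurable (fracSymbol σ a) := by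
  unfold fracSymbol
  have := measurable_sign
  fun_prop

lemma continuous_fracSymbol (σ : ℝ) (ha : 0 ≤ a) : Continuous (fracSymbol σ a) := by
  rcases ha.eq_or_lt with rfl | ha
  · simp only [funext (fracSymbol_zero_order σ)]
    exact continuous_const
  refine continuous_iff_continuousAt.2 fun y => ?_
  rcases eq_or_ne y 0 with rfl | hy
  · have h0 : fracSymbol σ a 0 = 0 := by
      simp [fracSymbol, Real.zero_rpow ha.ne']
    rw [ContinuousAt, h0, tendsto_zero_iff_norm_tendsto_zero]
    simp only [norm_fracSymbol]
    have : Continuous fun y : ℝ => |y| ^ a := continuous_abs.rpow_const fun _ => Or.inr ha.le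
    simpa [Real.zero_rpow ha.ne'] using this.tendsto 0
  · have hs : ∀ᶠ z in 𝓝 y, Real.sign z = Real.sign y := by
      rcases lt_or_gt_of_ne hy with h | h
      · filter_upwards [Iio_mem_nhds h] with z hz
        rw [Real.sign_of_neg h, Real.sign_of_neg hz]
      · filter_upwards [Ioi_mem_nhds h] with z hz
        rw [Real.sign_of_pos h, Real.sign_of_pos hz]
    have h1 : ContinuousAt (fun z : ℝ => ((|z| ^ a : ℝ) : ℂ) *
        Complex.exp (((σ * (Real.pi * a / 2) * Real.sign y : ℝ) : ℂ) * Complex.I)) y := by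
      have : Continuous fun y : ℝ => |y| ^ a := continuous_abs.rpow_const fun _ => Or.inr ha.le
      fun_prop
    refine h1.congr ?_
    filter_upwards [hs] with z hz
    rw [fracSymbol, hz]

end Symbol

/-! ### Absolute Gaussian moments -/

section GaussianMoment

variable {a l : ℝ}

lemma integrable_abs_rpow_mul_exp (ha : 0 ≤ a) (hl : 0 < l) :
    Integrable fun y : ℝ => |y| ^ a * Real.exp (-(l / 2) * y ^ 2) := by
  have h0 := integrable_exp_neg_mul_sq (b := l / 2) (by positivity)
  have h1 := (integrable_rpow_mul_exp_neg_mul_sq (b := l / 2) (by positivity)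
    (s := (⌈a⌉₊ : ℝ)) (by linarith [Nat.cast_nonneg (α := ℝ) ⌈a⌉₊])).norm
  refine (h0.add h1).mono' ?_ (ae_of_all _ fun y => ?_)
  · have : Continuous fun y : ℝ => |y| ^ a := continuous_abs.rpow_const fun _ => Or.inr ha
    exact Continuous.aestronglyMeasurable (by fun_prop)
  · have hle : |y| ^ a ≤ 1 + |y| ^ ⌈a⌉₊ := by
      rcases le_total |y| 1 with h | h
      · exact (Real.rpow_le_one (abs_nonneg y) h ha).trans (by simp)
      · rw [← Real.rpow_natCast]
        exact (Real.rpow_le_rpow_of_exponent_le h (Nat.le_ceil a)).trans (by simp)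
    simp only [Pi.add_apply, Real.norm_eq_abs, abs_mul, Real.abs_exp, Real.rpow_natCast, abs_pow]
    rw [abs_of_nonneg (Real.rpow_nonneg (abs_nonneg y) a)]
    nlinarith [Real.exp_pos (-(l / 2) * y ^ 2)]

/-- The absolute moment `∫ |y|^a e^{-y²/2} dy`. -/
def absMoment (a : ℝ) : ℝ := ∫ y : ℝ, |y| ^ a * Real.exp (-(1 / 2) * y ^ 2)

lemma absMoment_pos (ha : 0 ≤ a) : 0 < absMoment a := by
  refine (integral_pos_iff_support_of_nonneg (fun y => by positivity)
    (integrable_abs_rpow_mul_exp ha one_pos)).2 ?_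
  refine lt_of_lt_of_le ?_ (measure_mono (s := Set.Ioo 0 1) fun y hy => ?_)
  · simp
  · have : 0 < |y| := abs_pos.2 hy.1.ne'
    exact (by positivity : 0 < |y| ^ a * Real.exp (-(1 / 2) * y ^ 2)).ne'

lemma integral_abs_rpow_mul_exp (a : ℝ) (hl : 0 < l) :
    ∫ y : ℝ, |y| ^ a * Real.exp (-(l / 2) * y ^ 2) = l ^ (-((a + 1) / 2)) * absMoment a := by
  have hs : 0 < Real.sqrt l := Real.sqrt_pos.2 hl
  have h := Measure.integral_comp_mul_left
    (fun y : ℝ => |y| ^ a * Real.exp (-(1 / 2) * y ^ 2)) (Real.sqrt l)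
  have h1 : ∀ y : ℝ, |Real.sqrt l * y| ^ a * Real.exp (-(1 / 2) * (Real.sqrt l * y) ^ 2)
      = l ^ (a / 2) * (|y| ^ a * Real.exp (-(l / 2) * y ^ 2)) := by
    intro y
    rw [abs_mul, abs_of_pos hs, Real.mul_rpow hs.le (abs_nonneg y), mul_pow, Real.sq_sqrt hl.le,
      Real.sqrt_eq_rpow, ← Real.rpow_mul hl.le]
    ring_nf
  simp only [h1, integral_const_mul, smul_eq_mul] at h
  rw [abs_of_pos (inv_pos.2 hs)] at h
  have h2 : l ^ (-((a + 1) / 2)) = (l ^ (a / 2))⁻¹ * (Real.sqrt l)⁻¹ := by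
    rw [Real.sqrt_eq_rpow, ← Real.rpow_neg hl.le, ← Real.rpow_neg hl.le, ← Real.rpow_add hl]
    ring_nf
  rw [h2, absMoment, mul_assoc, ← h, ← mul_assoc, inv_mul_cancel₀ (by positivity), one_mul]

end GaussianMoment

/-! ### The one-dimensional kernel and the product formula -/

/-- The one-dimensional fractional derivative of the heat kernel. -/
def fracHeat (σ a ε u : ℝ) : ℂ :=
  (1 / (2 * Real.pi) : ℂ) * ∫ y : ℝ, fracSymbol σ a y * Complex.exp (Complex.I * ((y * u : ℝ) : ℂ)) *
    ((Real.exp (-(ε / 2) * y ^ 2) : ℝ) : ℂ)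

section FracHeat

variable {σ a ε : ℝ}

lemma norm_cexp_I_mul (u : ℝ) : ‖Complex.exp (Complex.I * (u : ℂ))‖ = 1 := by
  rw [mul_comm, Complex.norm_exp_ofReal_mul_I]

lemma norm_fracHeat_integrand (σ a ε u y : ℝ) :
    ‖fracSymbol σ a y * Complex.exp (Complex.I * ((y * u : ℝ) : ℂ)) *
      ((Real.exp (-(ε / 2) * y ^ 2) : ℝ) : ℂ)‖ = |y| ^ a * Real.exp (-(ε / 2) * y ^ 2) := by
  rw [norm_mul, norm_mul, norm_fracSymbol, norm_cexp_I_mul, Complex.norm_real, mul_one,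
    Real.norm_of_nonneg (Real.exp_pos _).le]

lemma aestronglyMeasurable_fracHeat_integrand (σ a ε u : ℝ) :
    AEStronglyMeasurable (fun y : ℝ => fracSymbol σ a y *
      Complex.exp (Complex.I * ((y * u : ℝ) : ℂ)) *
      ((Real.exp (-(ε / 2) * y ^ 2) : ℝ) : ℂ)) volume := by
  have := measurable_fracSymbol σ a
  exact Measurable.aestronglyMeasurable (by fun_prop)

lemma continuous_fracHeat (σ : ℝ) (ha : 0 ≤ a) (hε : 0 < ε) : Continuous (fracHeat σ a ε) := by
  refine continuous_const.mul (continuous_of_dominated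
    (fun u => aestronglyMeasurable_fracHeat_integrand σ a ε u)
    (fun u => ae_of_all _ fun y => (norm_fracHeat_integrand σ a ε u y).le)
    (integrable_abs_rpow_mul_exp ha hε) (ae_of_all _ fun y => by fun_prop))

lemma exists_norm_fracHeat_le (σ a ε : ℝ) : ∃ M : ℝ, ∀ u, ‖fracHeat σ a ε u‖ ≤ M := by
  refine ⟨‖(1 / (2 * Real.pi) : ℂ)‖ * ∫ y : ℝ, |y| ^ a * Real.exp (-(ε / 2) * y ^ 2), fun u => ?_⟩
  rw [fracHeat, norm_mul]
  refine mul_le_mul_of_nonneg_left ((norm_integral_le_integral_norm _).trans_eq ?_) (norm_nonneg _)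
  simp only [norm_fracHeat_integrand]

/-- The Fourier transform of a Gaussian is a positive Gaussian. This positivity serves twice: for
the kernel itself when all orders vanish, and for the increment integral in `diagIntegral_pos`. -/
lemma fracHeat_zero_order (σ : ℝ) (hε : 0 < ε) (u : ℝ) :
    ∃ r : ℝ, 0 < r ∧ fracHeat σ 0 ε u = r := by
  have h := fourierIntegral_gaussian (b := ((ε / 2 : ℝ) : ℂ)) (by simpa using hε) (u : ℂ)
  refine ⟨1 / (2 * Real.pi) * ((Real.pi / (ε / 2)) ^ (1 / 2 : ℝ) *
    Real.exp (-u ^ 2 / (4 * (ε / 2)))), by positivity, ?_⟩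
  have h2 : ((Real.pi : ℂ) / ((ε / 2 : ℝ) : ℂ)) ^ (1 / 2 : ℂ)
      = (((Real.pi / (ε / 2)) ^ (1 / 2 : ℝ) : ℝ) : ℂ) := by
    rw [Complex.ofReal_cpow (by positivity)]
    push_cast
    rfl
  rw [h2] at h
  rw [fracHeat]
  push_cast at h ⊢
  rw [← h]
  congr 1
  refine integral_congr_ae (ae_of_all _ fun y => ?_)
  simp only [fracSymbol_zero_order, one_mul]
  congr 2
  ring

lemma fracDerivHeatKernel_eq_prod {d : ℕ} (σ : ℝ) (α : Fin d → ℝ) (ε : ℝ)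
    (x : EuclideanSpace ℝ (Fin d)) :
    fracDerivHeatKernel σ α ε x = ∏ ℓ, fracHeat σ (α ℓ) ε (x ℓ) := by
  simp only [fracDerivHeatKernel, fracHeat, Finset.prod_mul_distrib]
  rw [← integral_fintype_prod_volume_eq_prod, ← (PiLp.volume_preserving_toLp (Fin d)).integral_comp
    (MeasurableEquiv.toLp 2 _).measurableEmbedding]
  congr 1
  · simp [← inv_pow, mul_comm]
  · refine integral_congr_ae (ae_of_all _ fun y => ?_)
    simp only [Finset.prod_mul_distrib, ← Complex.exp_sum, ← Finset.mul_sum, Complex.ofReal_exp]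
    congr 3
    · congr 1
      simp only [PiLp.inner_apply, RCLike.inner_apply, conj_trivial, Complex.ofReal_sum]
      exact Finset.sum_congr rfl fun i _ => by push_cast; ring
    · rw [EuclideanSpace.norm_eq, Real.sq_sqrt (by positivity)]
      simp only [Real.norm_eq_abs, sq_abs, Finset.mul_sum, Complex.ofReal_sum]

end FracHeat

/-! ### Covariances of the kernel as Gaussian integrals -/

/-- The product of `φ(y) conj φ(z) e^{ix(y-z)}` and `e^{-(A y² - 2 C y z + B z²)/2}`,
where `φ` is the fractional symbol. -/
def quadIntegrand (σ a x A B C : ℝ) (p : ℝ × ℝ) : ℂ :=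
  fracSymbol σ a p.1 * conj (fracSymbol σ a p.2) *
    Complex.exp (Complex.I * ((x * (p.1 - p.2) : ℝ) : ℂ)) *
    ((Real.exp (-(A * p.1 ^ 2 - 2 * C * (p.1 * p.2) + B * p.2 ^ 2) / 2) : ℝ) : ℂ)

section BilinearFormula

variable {Ω : Type*} [MeasurableSpace Ω] {P : Measure Ω} [IsProbabilityMeasure P]

/-- By Fubini the expectation falls on the phases alone and yields the joint characteristic
function. The two heat weights contribute only `ε` to each diagonal entry of the quadratic form. -/
lemma integral_fracHeat_mul_conj {σ a ε : ℝ} (ha : 0 ≤ a) (hε : 0 < ε) (x : ℝ) {U V : Ω → ℝ}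
    (hU : AEMeasurable U P) (hV : AEMeasurable V P) {A B C : ℝ}
    (hchar : ∀ y z : ℝ, ∫ ω, Complex.exp (Complex.I * ((y * U ω - z * V ω : ℝ) : ℂ)) ∂P =
      ((Real.exp (-(A * y ^ 2 - 2 * C * (y * z) + B * z ^ 2) / 2) : ℝ) : ℂ)) :
    ∫ ω, fracHeat σ a ε (U ω + x) * conj (fracHeat σ a ε (V ω + x)) ∂P =
      (1 / (2 * Real.pi) : ℂ) ^ 2 *
        ∫ p : ℝ × ℝ, quadIntegrand σ a x (A + ε) (B + ε) C p := by
  set f : ℝ → ℝ → ℂ := fun u y => fracSymbol σ a y * Complex.exp (Complex.I * ((y * u : ℝ) : ℂ)) *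
    ((Real.exp (-(ε / 2) * y ^ 2) : ℝ) : ℂ) with hf
  have hprod : ∀ ω, fracHeat σ a ε (U ω + x) * conj (fracHeat σ a ε (V ω + x)) =
      (1 / (2 * Real.pi) : ℂ) ^ 2 *
        ∫ p : ℝ × ℝ, f (U ω + x) p.1 * conj (f (V ω + x) p.2) := by
    intro ω
    rw [Measure.volume_eq_prod, integral_prod_mul (f (U ω + x)) (fun z => conj (f (V ω + x) z)),
      integral_conj]
    simp only [fracHeat, map_mul, hf]
    have : conj (1 / (2 * Real.pi) : ℂ) = (1 / (2 * Real.pi) : ℂ) := by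
      simp [Complex.conj_ofReal, map_ofNat]
    rw [this]
    ring
  simp only [hprod]
  rw [integral_const_mul]
  congr 1
  have hnorm : ∀ u v y z, ‖f u y * conj (f v z)‖ =
      (|y| ^ a * Real.exp (-(ε / 2) * y ^ 2)) * (|z| ^ a * Real.exp (-(ε / 2) * z ^ 2)) := by
    intro u v y z
    rw [norm_mul, RCLike.norm_conj, norm_fracHeat_integrand, norm_fracHeat_integrand]
  have hmeas : AEStronglyMeasurable (fun q : Ω × (ℝ × ℝ) =>
      f (U q.1 + x) q.2.1 * conj (f (V q.1 + x) q.2.2)) (P.prod volume) := by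
    have h1 := measurable_fracSymbol σ a
    have h2 : AEMeasurable (fun q : Ω × (ℝ × ℝ) => (U q.1, V q.1, q.2)) (P.prod volume) :=
      (hU.comp_quasiMeasurePreserving Measure.quasiMeasurePreserving_fst).prodMk
        ((hV.comp_quasiMeasurePreserving Measure.quasiMeasurePreserving_fst).prodMk
          measurable_snd.aemeasurable)
    have h3 : Measurable (fun q : ℝ × ℝ × (ℝ × ℝ) =>
        f (q.1 + x) q.2.2.1 * conj (f (q.2.1 + x) q.2.2.2)) := by
      have hc : Continuous (conj : ℂ → ℂ) := Complex.continuous_conj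
      refine Measurable.mul ?_ (hc.measurable.comp ?_) <;> · simp only [hf]; fun_prop
    exact (h3.comp_aemeasurable h2).aestronglyMeasurable
  have hint : Integrable (fun q : Ω × (ℝ × ℝ) =>
      f (U q.1 + x) q.2.1 * conj (f (V q.1 + x) q.2.2)) (P.prod volume) := by
    have h1 := integrable_abs_rpow_mul_exp ha hε
    have h2 := (integrable_const (μ := P) (1 : ℝ)).mul_prod (h1.mul_prod h1)
    refine h2.mono' hmeas (ae_of_all _ fun q => ?_)
    rw [hnorm, one_mul]
  rw [integral_integral_swap hint]
  refine integral_congr_ae (ae_of_all _ fun p => ?_)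
  have h1 : ∀ ω, f (U ω + x) p.1 * conj (f (V ω + x) p.2) =
      (fracSymbol σ a p.1 * conj (fracSymbol σ a p.2) *
        Complex.exp (Complex.I * ((x * (p.1 - p.2) : ℝ) : ℂ)) *
        ((Real.exp (-(ε / 2) * p.1 ^ 2) * Real.exp (-(ε / 2) * p.2 ^ 2) : ℝ) : ℂ)) *
      Complex.exp (Complex.I * ((p.1 * U ω - p.2 * V ω : ℝ) : ℂ)) := by
    intro ω
    have h2 : Complex.exp (Complex.I * ((p.1 * (U ω + x) : ℝ) : ℂ)) *
        conj (Complex.exp (Complex.I * ((p.2 * (V ω + x) : ℝ) : ℂ))) =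
        Complex.exp (Complex.I * ((x * (p.1 - p.2) : ℝ) : ℂ)) *
        Complex.exp (Complex.I * ((p.1 * U ω - p.2 * V ω : ℝ) : ℂ)) := by
      rw [← Complex.exp_conj, ← Complex.exp_add, ← Complex.exp_add]
      congr 1
      simp only [map_mul, Complex.conj_I, Complex.conj_ofReal]
      push_cast
      ring
    simp only [hf, map_mul, Complex.conj_ofReal] at h2 ⊢
    push_cast at h2 ⊢
    linear_combination (fracSymbol σ a p.1 * conj (fracSymbol σ a p.2) *
      Complex.exp (-(ε / 2) * p.1 ^ 2) * Complex.exp (-(ε / 2) * p.2 ^ 2)) * h2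
  simp only [h1]
  rw [integral_const_mul, hchar, quadIntegrand, mul_assoc, ← Complex.ofReal_mul, ← Real.exp_add,
    ← Real.exp_add]
  congr 4
  ring

end BilinearFormula

/-! ### From conditional variances to bounds on the covariance function -/

/-- The mean squared error of an approximation by a multiple of `Y_s` is at least the mean
conditional variance given `Y_s`. -/
lemma integral_condVar_le_integral_sq {Ω : Type*} {m mΩ : MeasurableSpace Ω} {P : Measure[mΩ] Ω}
    [IsProbabilityMeasure P] {U V : Ω → ℝ} (hU : MemLp U 2 P)
    (hV : MemLp V 2 P) (hVm : Measurable[mΩ] V) (l : ℝ)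
    (hm : m = MeasurableSpace.comap V inferInstance) :
    ∫ ω, (Var[U; P | m]) ω ∂P ≤ ∫ ω, (U ω - l * V ω) ^ 2 ∂P := by
  have hmle : m ≤ mΩ := hm ▸ hVm.comap_le
  have hVm' : StronglyMeasurable[m] (fun ω => l * V ω) := by
    have h1 : Measurable[m] V := by rw [hm]; exact comap_measurable V
    exact (h1.const_mul l).stronglyMeasurable
  have hlV : MemLp (fun ω => l * V ω) 2 P := hV.const_mul l
  have hZ : MemLp (U - fun ω => l * V ω) 2 P := hU.sub hlV
  -- Subtracting an `m`-measurable variable leaves the conditional variance unchanged; the law of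
  -- total variance then bounds its mean by the full variance.
  have h1 : Var[U - fun ω => l * V ω; P | m] =ᵐ[P] Var[U; P | m] := by
    refine condExp_congr_ae ?_
    have h2 := condExp_sub (hU.integrable one_le_two) (hlV.integrable one_le_two) m
    rw [condExp_of_stronglyMeasurable hmle hVm' (hlV.integrable one_le_two)] at h2
    filter_upwards [h2] with ω hω
    simp only [Pi.pow_apply, Pi.sub_apply, hω]
    ring
  rw [← integral_congr_ae h1]
  have h3 := integral_condVar_add_variance_condExp hmle hZ
  have h4 := variance_nonneg (P[U - fun ω => l * V ω | m]) P
  have h5 : Var[U - fun ω => l * V ω; P] ≤ ∫ ω, (U ω - l * V ω) ^ 2 ∂P :=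
    variance_le_expectation_sq hZ.aestronglyMeasurable
  linarith

section Covariance

variable {Ω : Type*} [MeasurableSpace Ω] {P : Measure Ω}
  {Y : ℝ≥0 → Ω → ℝ}

/-- The second moment `E[Y_t Y_s]`. -/
def cov (Y : ℝ≥0 → Ω → ℝ) (P : Measure Ω) (t s : ℝ≥0) : ℝ := ∫ ω, Y t ω * Y s ω ∂P

lemma cov_comm (t s : ℝ≥0) : cov Y P t s = cov Y P s t := by
  simp only [cov, mul_comm]

lemma integral_sq_linear (hY : IsGaussianProcess Y P) (t s : ℝ≥0) (y z : ℝ) :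
    ∫ ω, (y * Y t ω - z * Y s ω) ^ 2 ∂P =
      cov Y P t t * y ^ 2 - 2 * cov Y P t s * (y * z) + cov Y P s s * z ^ 2 := by
  have ht := (hY.hasGaussianLaw_eval t).memLp_two
  have hs := (hY.hasGaussianLaw_eval s).memLp_two
  have h1 : Integrable (fun ω => Y t ω * Y t ω) P := ht.integrable_mul ht
  have h2 : Integrable (fun ω => Y t ω * Y s ω) P := ht.integrable_mul hs
  have h3 : Integrable (fun ω => Y s ω * Y s ω) P := hs.integrable_mul hs
  have h4 : ∀ ω, (y * Y t ω - z * Y s ω) ^ 2 =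
      y ^ 2 * (Y t ω * Y t ω) - (2 * (y * z)) * (Y t ω * Y s ω) + z ^ 2 * (Y s ω * Y s ω) :=
    fun ω => by ring
  simp only [h4]
  have h5 : Integrable (fun ω => y ^ 2 * (Y t ω * Y t ω) - (2 * (y * z)) * (Y t ω * Y s ω)) P :=
    (h1.const_mul _).sub (h2.const_mul _)
  rw [integral_add h5 (h3.const_mul _), integral_sub (h1.const_mul _) (h2.const_mul _),
    integral_const_mul, integral_const_mul, integral_const_mul]
  simp only [cov]
  ring

lemma integral_sq_eq_cov (t : ℝ≥0) : ∫ ω, (Y t ω) ^ 2 ∂P = cov Y P t t := by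
  simp only [cov, sq]

lemma integral_sq_sub (hY : IsGaussianProcess Y P) (t s : ℝ≥0) :
    ∫ ω, (Y t ω - Y s ω) ^ 2 ∂P = cov Y P t t - 2 * cov Y P t s + cov Y P s s := by
  simpa using integral_sq_linear hY t s 1 1

lemma integral_sub_mul (hY : IsGaussianProcess Y P) (t s : ℝ≥0) :
    ∫ ω, (Y t ω - Y s ω) * Y s ω ∂P = cov Y P t s - cov Y P s s := by
  have ht := (hY.hasGaussianLaw_eval t).memLp_two
  have hs := (hY.hasGaussianLaw_eval s).memLp_two
  have h2 : Integrable (fun ω => Y t ω * Y s ω) P := ht.integrable_mul hs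
  have h3 : Integrable (fun ω => Y s ω * Y s ω) P := hs.integrable_mul hs
  simp only [sub_mul]
  rw [integral_sub h2 h3]
  rfl

lemma integral_cexp_linear (hY : IsGaussianProcess Y P) (hc : ∀ t, ∫ ω, Y t ω ∂P = 0)
    (t s : ℝ≥0) (y z : ℝ) :
    ∫ ω, Complex.exp (Complex.I * ((y * Y t ω - z * Y s ω : ℝ) : ℂ)) ∂P =
      ((Real.exp (-(cov Y P t t * y ^ 2 - 2 * cov Y P t s * (y * z) + cov Y P s s * z ^ 2) / 2) :
        ℝ) : ℂ) := by
  set W : Ω → ℝ := fun ω => y * Y t ω - z * Y s ω with hW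
  have hg : HasGaussianLaw W P := by
    have := (hY.hasGaussianLaw_prodMk (s := t) (t := s)).map_fun
      (y • ContinuousLinearMap.fst ℝ ℝ ℝ - z • ContinuousLinearMap.snd ℝ ℝ ℝ)
    simpa using this
  have h0 : P[W] = 0 := by
    have ht := (hY.hasGaussianLaw_eval t).integrable
    have hs := (hY.hasGaussianLaw_eval s).integrable
    simp only [hW]
    rw [integral_sub (ht.const_mul y) (hs.const_mul z), integral_const_mul, integral_const_mul,
      hc, hc]
    simp
  have hv : Var[W; P] =
      cov Y P t t * y ^ 2 - 2 * cov Y P t s * (y * z) + cov Y P s s * z ^ 2 := by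
    rw [variance_eq_integral hg.aemeasurable, h0, ← integral_sq_linear hY]
    simp [hW]
  have h := charFun_gaussianReal (μ := P[W]) (v := Var[W; P].toNNReal) 1
  rw [← hg.map_eq_gaussianReal, charFun_apply_real,
    integral_map hg.aemeasurable (by fun_prop)] at h
  rw [Real.coe_toNNReal _ (variance_nonneg _ _), h0, hv] at h
  rw [Complex.ofReal_exp]
  convert h using 2
  · ext ω
    congr 1
    simp only [hW]
    push_cast
    ring
  · push_cast
    ring_nf

/-- Quantitative nondegeneracy of a covariance function on `[0, ∞)`, as implied by strong local
nondeterminism and an upper bound on the variance of increments. -/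
structure CovBounds (R : ℝ≥0 → ℝ≥0 → ℝ) (H κ K : ℝ) : Prop where
  symm : ∀ t s, R t s = R s t
  diag_nonneg : ∀ t, 0 ≤ R t t
  le_diag : ∀ t : ℝ≥0, 0 < t → κ * (t : ℝ) ^ (2 * H) ≤ R t t
  le_det : ∀ t s : ℝ≥0, 0 < t → 0 < s →
    κ * min (|(t : ℝ) - s| ^ (2 * H)) ((t : ℝ) ^ (2 * H)) * R s s ≤ R t t * R s s - R t s ^ 2
  incr_le : ∀ t s : ℝ≥0, R t t - 2 * R t s + R s s ≤ K * |(t : ℝ) - s| ^ (2 * H)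

/-- Averaging local nondeterminism with a single conditioning time bounds from below the error of
every linear predictor `l * Y s` of `Y t`; the bounds result from particular choices of `l` and `s`.
-/
lemma exists_covBounds [IsProbabilityMeasure P] (hY : IsGaussianProcess Y P)
    (hmeas : ∀ t, Measurable (Y t)) {H : ℝ}
    (hS : SLND Y H P) (hK : IncrementVarianceBound Y H P) :
    ∃ κ K : ℝ, 0 < κ ∧ 0 < K ∧ CovBounds (cov Y P) H κ K := by
  obtain ⟨κ, hκ, hκ'⟩ := hS
  obtain ⟨K, hK0, hK'⟩ := hK
  have key : ∀ t s : ℝ≥0, 0 < t → 0 < s → ∀ l : ℝ,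
      κ * min (|(t : ℝ) - s| ^ (2 * H)) ((t : ℝ) ^ (2 * H)) ≤
        cov Y P t t - 2 * cov Y P t s * l + cov Y P s s * l ^ 2 := by
    intro t s ht hs l
    have h1 := hκ' 0 (fun _ => s) t (fun _ => hs) ht
    rw [ciInf_const] at h1
    have h2 := integral_condVar_le_integral_sq (hY.hasGaussianLaw_eval t).memLp_two
      (hY.hasGaussianLaw_eval s).memLp_two (hmeas s) l
      (m := ⨆ _ : Fin (0 + 1), MeasurableSpace.comap (Y s) inferInstance) ciSup_const
    have h3 := integral_mono_ae (integrable_const _) integrable_condVar h1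
    have h4 := integral_sq_linear hY t s 1 l
    simp only [one_mul, one_pow, mul_one] at h4
    rw [integral_const, probReal_univ, one_smul] at h3
    linarith
  have hdiag : ∀ t : ℝ≥0, 0 < t → κ * (t : ℝ) ^ (2 * H) ≤ cov Y P t t := by
    intro t ht
    -- At least one conditioning time is required; `2 * t` lies at distance exactly `t`, so both
    -- terms of the minimum agree.
    have h := key t (2 * t) ht (by positivity) 0
    have h1 : |(t : ℝ) - (2 * t : ℝ≥0)| = t := by
      push_cast
      rw [abs_sub_comm, abs_of_nonneg (by linarith [t.coe_nonneg])]
      ring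
    rw [h1, min_self] at h
    linarith
  refine ⟨κ, K, hκ, hK0, cov_comm, fun t => ?_, hdiag, fun t s ht hs => ?_, fun t s => ?_⟩
  · exact integral_nonneg fun ω => mul_self_nonneg _
  · have hb : 0 < cov Y P s s :=
      lt_of_lt_of_le (mul_pos hκ (Real.rpow_pos_of_pos (by exact_mod_cast hs) _)) (hdiag s hs)
    -- The regression coefficient: the prediction error becomes the determinant divided by `cov Y P
    -- s s`.
    have h := mul_le_mul_of_nonneg_right (key t s ht hs (cov Y P t s / cov Y P s s)) hb.le
    refine h.trans_eq ?_
    field_simp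
    ring
  · rw [← integral_sq_sub hY]
    exact hK' t s

end Covariance

/-! ### Gaussian integrals under a determinant bound -/

lemma quadForm_ge {A B C q : ℝ} (hA : 0 ≤ A) (hB : 0 ≤ B) (hq1 : q ≤ 1)
    (h : C ^ 2 ≤ (1 - q) * (A * B)) (y z : ℝ) :
    q / 2 * (A * y ^ 2 + B * z ^ 2) ≤ A * y ^ 2 - 2 * C * (y * z) + B * z ^ 2 := by
  have hAB : 0 ≤ A * B := mul_nonneg hA hB
  have h1 : C ^ 2 ≤ (1 - q / 2) ^ 2 * (A * B) := by nlinarith [mul_nonneg (sq_nonneg q) hAB]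
  have hS : 0 ≤ A * y ^ 2 + B * z ^ 2 := by positivity
  have h2 : (2 * C * (y * z)) ^ 2 ≤ ((1 - q / 2) * (A * y ^ 2 + B * z ^ 2)) ^ 2 := by
    have h3 : C ^ 2 * (y * z) ^ 2 ≤ (1 - q / 2) ^ 2 * (A * B) * (y * z) ^ 2 :=
      mul_le_mul_of_nonneg_right h1 (sq_nonneg _)
    nlinarith [mul_nonneg (sq_nonneg (1 - q / 2)) (sq_nonneg (A * y ^ 2 - B * z ^ 2))]
  have h4 := abs_le_of_sq_le_sq h2 (mul_nonneg (by linarith) hS)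
  linarith [(abs_le.1 h4).2]

section QuadIntegral

variable {σ a x A B C q : ℝ}

lemma norm_quadIntegrand (p : ℝ × ℝ) : ‖quadIntegrand σ a x A B C p‖ = |p.1| ^ a * |p.2| ^ a *
    Real.exp (-(A * p.1 ^ 2 - 2 * C * (p.1 * p.2) + B * p.2 ^ 2) / 2) := by
  rw [quadIntegrand, norm_mul, norm_mul, norm_mul, RCLike.norm_conj, norm_fracSymbol,
    norm_fracSymbol, norm_cexp_I_mul, Complex.norm_real, mul_one,
    Real.norm_of_nonneg (Real.exp_pos _).le]

lemma norm_quadIntegrand_le (hA : 0 ≤ A) (hB : 0 ≤ B) (hq1 : q ≤ 1)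
    (h : C ^ 2 ≤ (1 - q) * (A * B)) (p : ℝ × ℝ) : ‖quadIntegrand σ a x A B C p‖ ≤
      (|p.1| ^ a * Real.exp (-(q / 2 * A / 2) * p.1 ^ 2)) *
        (|p.2| ^ a * Real.exp (-(q / 2 * B / 2) * p.2 ^ 2)) := by
  rw [norm_quadIntegrand, mul_mul_mul_comm (|p.1| ^ a), ← Real.exp_add]
  refine mul_le_mul_of_nonneg_left (Real.exp_le_exp.2 ?_) (by positivity)
  have := quadForm_ge hA hB hq1 h p.1 p.2
  linarith

lemma integrable_quadIntegrand (ha : 0 ≤ a) (hA : 0 < A) (hB : 0 < B) (hq : 0 < q) (hq1 : q ≤ 1)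
    (h : C ^ 2 ≤ (1 - q) * (A * B)) : Integrable (quadIntegrand σ a x A B C) := by
  have h1 := (integrable_abs_rpow_mul_exp ha (l := q / 2 * A) (by positivity)).mul_prod
    (integrable_abs_rpow_mul_exp ha (l := q / 2 * B) (by positivity))
  refine h1.mono' ?_ (ae_of_all _ fun p => norm_quadIntegrand_le hA.le hB.le hq1 h p)
  have h2 := continuous_fracSymbol σ ha
  have h3 := Complex.continuous_conj
  unfold quadIntegrand
  exact Continuous.aestronglyMeasurable (by fun_prop)

/-- A form with correlation bounded away from one dominates a multiple of its diagonal part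
(`quadForm_ge`), so the absolute integral splits into two one-dimensional moments. Each variable
contributes the power `-(a + 1) / 2`, the source of the off-diagonal exponent `p'`. -/
lemma norm_integral_quadIntegrand_le (ha : 0 ≤ a) (hA : 0 < A) (hB : 0 < B) (hq : 0 < q)
    (hq1 : q ≤ 1) (h : C ^ 2 ≤ (1 - q) * (A * B)) :
    ‖∫ p, quadIntegrand σ a x A B C p‖ ≤
      ((q / 2) ^ (-((a + 1) / 2)) * absMoment a) ^ 2 *
        (A ^ (-((a + 1) / 2)) * B ^ (-((a + 1) / 2))) := by
  have h1 := (integrable_abs_rpow_mul_exp ha (l := q / 2 * A) (by positivity)).mul_prod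
    (integrable_abs_rpow_mul_exp ha (l := q / 2 * B) (by positivity))
  refine (norm_integral_le_of_norm_le h1
    (ae_of_all _ fun p => norm_quadIntegrand_le hA.le hB.le hq1 h p)).trans_eq ?_
  rw [integral_prod_mul (fun y : ℝ => |y| ^ a * Real.exp (-(q / 2 * A / 2) * y ^ 2))
    (fun z : ℝ => |z| ^ a * Real.exp (-(q / 2 * B / 2) * z ^ 2)),
    integral_abs_rpow_mul_exp a (by positivity), integral_abs_rpow_mul_exp a (by positivity),
    Real.mul_rpow (by positivity) hA.le, Real.mul_rpow (by positivity) hB.le]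
  ring

end QuadIntegral

/-! ### The rescaled covariance near the diagonal -/

/-- The integrand of the covariance after passing to the increment variable `w = y - z` and
rescaling; here `p = (δ, r, A)` and `v = (w, u)`. -/
def diagIntegrand (σ a x : ℝ) (p : ℝ × ℝ × ℝ) (v : ℝ × ℝ) : ℂ :=
  fracSymbol σ a (v.2 + p.1 * v.1) * conj (fracSymbol σ a v.2) *
    Complex.exp (Complex.I * ((x * v.1 : ℝ) : ℂ)) *
    ((Real.exp (-(p.2.2 * v.1 ^ 2 + 2 * p.2.1 * (v.1 * v.2) + v.2 ^ 2) / 2) : ℝ) : ℂ)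

/-- The rescaled covariance near the diagonal. -/
def diagIntegral (σ a x : ℝ) (p : ℝ × ℝ × ℝ) : ℂ := ∫ v : ℝ × ℝ, diagIntegrand σ a x p v

/-- The parameters of `diagIntegral` that occur near the diagonal. -/
def diagParam (a₀ a₁ q : ℝ) : Set (ℝ × ℝ × ℝ) :=
  {p | 0 ≤ p.1 ∧ p.1 ≤ 1 ∧ a₀ ≤ p.2.2 ∧ p.2.2 ≤ a₁ ∧ p.2.1 ^ 2 ≤ (1 - q) * p.2.2}

section DiagIntegral

variable {σ a x a₀ a₁ q : ℝ}

lemma isCompact_diagParam (hq : 0 < q) (ha₀ : 0 < a₀) : IsCompact (diagParam a₀ a₁ q) := by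
  refine IsCompact.of_isClosed_subset
    (isCompact_Icc (a := ((0 : ℝ), (-(a₁ + 1), a₀))) (b := ((1 : ℝ), (a₁ + 1, a₁)))) ?_ ?_
  · have h : diagParam a₀ a₁ q = {p | 0 ≤ p.1} ∩ ({p | p.1 ≤ 1} ∩ ({p | a₀ ≤ p.2.2} ∩
        ({p | p.2.2 ≤ a₁} ∩ {p | p.2.1 ^ 2 ≤ (1 - q) * p.2.2}))) := rfl
    rw [h]
    refine (isClosed_le ?_ ?_).inter ((isClosed_le ?_ ?_).inter ((isClosed_le ?_ ?_).inter
      ((isClosed_le ?_ ?_).inter (isClosed_le ?_ ?_)))) <;> fun_prop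
  · rintro ⟨δ, r, A⟩ ⟨h1, h2, h3, h4, h5⟩
    simp only at h1 h2 h3 h4 h5
    have h6 : r ^ 2 ≤ a₁ := by nlinarith
    exact ⟨⟨h1, by simp only; nlinarith, h3⟩, ⟨h2, by simp only; nlinarith, h4⟩⟩

/-- An integrable bound for `diagIntegrand` on `diagParam`. -/
def diagBound (a a₀ q : ℝ) (v : ℝ × ℝ) : ℝ :=
  (2 : ℝ) ^ a * (Real.exp (-(q / 2 * a₀ / 2) * v.1 ^ 2) *
      (|v.2| ^ (a + a) * Real.exp (-(q / 2 / 2) * v.2 ^ 2)) +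
    (|v.1| ^ a * Real.exp (-(q / 2 * a₀ / 2) * v.1 ^ 2)) *
      (|v.2| ^ a * Real.exp (-(q / 2 / 2) * v.2 ^ 2)))

lemma integrable_diagBound (ha : 0 ≤ a) (hq : 0 < q) (ha₀ : 0 < a₀) :
    Integrable (diagBound a a₀ q) := by
  have h0 := integrable_abs_rpow_mul_exp le_rfl (l := q / 2 * a₀) (by positivity)
  simp only [Real.rpow_zero, one_mul] at h0
  have h1 := integrable_abs_rpow_mul_exp ha (l := q / 2 * a₀) (by positivity)
  have h2 := integrable_abs_rpow_mul_exp ha (l := q / 2) (by positivity)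
  have h3 := integrable_abs_rpow_mul_exp (add_nonneg ha ha) (l := q / 2) (by positivity)
  exact ((h0.mul_prod h3).add (h1.mul_prod h2)).const_mul _

lemma abs_add_rpow_le (ha : 0 ≤ a) (u w : ℝ) : |u + w| ^ a ≤ 2 ^ a * (|u| ^ a + |w| ^ a) := by
  have h : |u + w| ≤ 2 * max |u| |w| := by
    have := abs_add_le u w
    linarith [le_max_left |u| |w|, le_max_right |u| |w|]
  refine (Real.rpow_le_rpow (abs_nonneg _) h ha).trans ?_
  rw [Real.mul_rpow (by norm_num) (le_max_of_le_left (abs_nonneg u))]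
  refine mul_le_mul_of_nonneg_left ?_ (by positivity)
  rcases max_cases |u| |w| with h | h <;> rw [h.1]
  · exact le_add_of_nonneg_right (by positivity)
  · exact le_add_of_nonneg_left (by positivity)

lemma norm_diagIntegrand_le (ha : 0 ≤ a) (hq : 0 < q) (hq1 : q ≤ 1) (ha₀ : 0 < a₀)
    {p : ℝ × ℝ × ℝ} (hp : p ∈ diagParam a₀ a₁ q) (v : ℝ × ℝ) :
    ‖diagIntegrand σ a x p v‖ ≤ diagBound a a₀ q v := by
  obtain ⟨h1, h2, h3, h4, h5⟩ := hp
  rw [diagIntegrand, norm_mul, norm_mul, norm_mul, RCLike.norm_conj, norm_fracSymbol,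
    norm_fracSymbol, norm_cexp_I_mul, Complex.norm_real, mul_one,
    Real.norm_of_nonneg (Real.exp_pos _).le]
  have hquad := quadForm_ge (A := p.2.2) (B := 1) (C := -p.2.1) (ha₀.le.trans h3) zero_le_one hq1
    (by nlinarith) v.1 v.2
  have hexp : Real.exp (-(p.2.2 * v.1 ^ 2 + 2 * p.2.1 * (v.1 * v.2) + v.2 ^ 2) / 2) ≤
      Real.exp (-(q / 2 * a₀ / 2) * v.1 ^ 2) * Real.exp (-(q / 2 / 2) * v.2 ^ 2) := by
    rw [← Real.exp_add]
    refine Real.exp_le_exp.2 ?_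
    have h6 : q / 2 * (a₀ * v.1 ^ 2) ≤ q / 2 * (p.2.2 * v.1 ^ 2) := by gcongr
    nlinarith
  have habs : |v.2 + p.1 * v.1| ^ a ≤ 2 ^ a * (|v.2| ^ a + |v.1| ^ a) := by
    refine (abs_add_rpow_le ha _ _).trans ?_
    have h6 : |p.1 * v.1| ≤ |v.1| := by
      rw [abs_mul, abs_of_nonneg h1]
      exact mul_le_of_le_one_left (abs_nonneg _) h2
    gcongr
  calc _ ≤ (2 ^ a * (|v.2| ^ a + |v.1| ^ a)) * |v.2| ^ a *
        (Real.exp (-(q / 2 * a₀ / 2) * v.1 ^ 2) * Real.exp (-(q / 2 / 2) * v.2 ^ 2)) := by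
        gcongr
    _ = _ := by
        rw [diagBound, Real.rpow_add_of_nonneg (abs_nonneg _) ha ha]
        ring

lemma continuous_diagIntegrand (ha : 0 ≤ a) :
    Continuous fun z : (ℝ × ℝ × ℝ) × (ℝ × ℝ) => diagIntegrand σ a x z.1 z.2 := by
  have h2 := continuous_fracSymbol σ ha
  have h3 := Complex.continuous_conj
  unfold diagIntegrand
  fun_prop

lemma integrable_diagIntegrand (ha : 0 ≤ a) (hq : 0 < q) (hq1 : q ≤ 1) (ha₀ : 0 < a₀)
    {p : ℝ × ℝ × ℝ} (hp : p ∈ diagParam a₀ a₁ q) : Integrable (diagIntegrand σ a x p) := by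
  refine (integrable_diagBound ha hq ha₀).mono' ?_
    (ae_of_all _ (norm_diagIntegrand_le ha hq hq1 ha₀ hp))
  exact ((continuous_diagIntegrand ha).comp (by fun_prop : Continuous fun v : ℝ × ℝ =>
    (p, v))).aestronglyMeasurable

lemma continuousOn_diagIntegral (ha : 0 ≤ a) (hq : 0 < q) (hq1 : q ≤ 1) (ha₀ : 0 < a₀) :
    ContinuousOn (diagIntegral σ a x) (diagParam a₀ a₁ q) := by
  intro p hp
  refine continuousWithinAt_of_dominated ?_ ?_ (integrable_diagBound ha hq ha₀) ?_
  · filter_upwards [self_mem_nhdsWithin] with p hp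
    exact (integrable_diagIntegrand ha hq hq1 ha₀ hp).aestronglyMeasurable
  · filter_upwards [self_mem_nhdsWithin] with p hp
    exact ae_of_all _ (norm_diagIntegrand_le ha hq hq1 ha₀ hp)
  · exact ae_of_all _ fun v => ((continuous_diagIntegrand ha).comp
      (by fun_prop : Continuous fun p : ℝ × ℝ × ℝ => (p, v))).continuousWithinAt

/-- With `δ = 0` both symbols are evaluated at `u`, so the phases cancel and the integrand is
`|u|^{2a}` times a Gaussian, for any correlation `r`. -/
lemma diagIntegral_pos_of_eq_zero (ha : 0 ≤ a) (hq : 0 < q) (hq1 : q ≤ 1) (ha₀ : 0 < a₀)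
    {p : ℝ × ℝ × ℝ} (hp : p ∈ diagParam a₀ a₁ q) (hp0 : p.1 = 0) :
    ∃ r : ℝ, 0 < r ∧ diagIntegral σ a 0 p = r := by
  set f : ℝ × ℝ → ℝ := fun v => (|v.2| ^ a) ^ 2 *
    Real.exp (-(p.2.2 * v.1 ^ 2 + 2 * p.2.1 * (v.1 * v.2) + v.2 ^ 2) / 2) with hf
  have heq : ∀ v, diagIntegrand σ a 0 p v = (f v : ℂ) := by
    intro v
    rw [diagIntegrand, hp0, zero_mul, add_zero, fracSymbol_mul_conj]
    simp [hf]
  have hint : Integrable f := by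
    have h := (integrable_diagIntegrand (σ := σ) (x := 0) ha hq hq1 ha₀ hp).re
    refine h.congr (ae_of_all _ fun v => ?_)
    simp only [heq]
    exact Complex.ofReal_re _
  refine ⟨∫ v, f v, ?_, ?_⟩
  · refine (integral_pos_iff_support_of_nonneg (fun v => by simp only [hf]; positivity) hint).2 ?_
    refine lt_of_lt_of_le ?_ (measure_mono (s := Set.univ ×ˢ Set.Ioo (0 : ℝ) 1) fun v hv => ?_)
    · rw [Measure.volume_eq_prod, Measure.prod_prod]
      simp
    · have : 0 < |v.2| := abs_pos.2 hv.2.1.ne'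
      exact (by simp only [hf]; positivity : 0 < f v).ne'
  · rw [diagIntegral, ← integral_complex_ofReal]
    simp only [heq]

/-- With `r = 0` as well, the integral factors: the `w`-part is the Fourier transform of a Gaussian
at `x`, hence positive despite the oscillation, and the `u`-part is an absolute moment. -/
lemma diagIntegral_pos (ha : 0 ≤ a) {A : ℝ} (hA : 0 < A) :
    ∃ r : ℝ, 0 < r ∧ diagIntegral σ a x (0, 0, A) = r := by
  obtain ⟨r, hr, hr'⟩ := fracHeat_zero_order σ hA x
  refine ⟨2 * Real.pi * r * absMoment (a + a), ?_, ?_⟩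
  · have := absMoment_pos (add_nonneg ha ha)
    positivity
  · rw [fracHeat] at hr'
    have h1 : ∫ y : ℝ, fracSymbol σ 0 y * Complex.exp (Complex.I * ((y * x : ℝ) : ℂ)) *
        ((Real.exp (-(A / 2) * y ^ 2) : ℝ) : ℂ) = 2 * Real.pi * r := by
      rw [← hr']
      rw [← mul_assoc, mul_one_div_cancel (by simp [Real.pi_ne_zero]), one_mul]
    push_cast
    rw [← h1, absMoment, ← integral_complex_ofReal, diagIntegral, ← integral_prod_mul]
    refine integral_congr_ae (ae_of_all _ fun v => ?_)
    simp only [diagIntegrand, zero_mul, add_zero, fracSymbol_mul_conj, fracSymbol_zero_order,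
      one_mul, mul_zero]
    rw [Real.rpow_add_of_nonneg (abs_nonneg _) ha ha, ← sq]
    have h2 : Real.exp (-(A * v.1 ^ 2 + v.2 ^ 2) / 2) =
        Real.exp (-(A / 2) * v.1 ^ 2) * Real.exp (-(1 / 2) * v.2 ^ 2) := by
      rw [← Real.exp_add]
      ring_nf
    rw [h2, mul_comm x]
    push_cast
    ring

lemma exists_le_near {E : Type*} [PseudoMetricSpace E] {f : E → ℝ} {S Z : Set E}
    (hS : IsCompact S) (hf : ContinuousOn f S) (hZ : IsCompact Z) (hZS : Z ⊆ S)
    (hpos : ∀ z ∈ Z, 0 < f z) :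
    ∃ η c : ℝ, 0 < η ∧ 0 < c ∧ ∀ p ∈ S, ∀ z ∈ Z, dist p z < η → c ≤ f p := by
  rcases Z.eq_empty_or_nonempty with rfl | hne
  · exact ⟨1, 1, one_pos, one_pos, fun _ _ z hz => absurd hz (Set.notMem_empty z)⟩
  obtain ⟨z₀, hz₀, hmin⟩ := hZ.exists_isMinOn hne (hf.mono hZS)
  have hc : 0 < f z₀ / 2 := half_pos (hpos z₀ hz₀)
  obtain ⟨η, hη, h⟩ := Metric.uniformContinuousOn_iff.1
    (hS.uniformContinuousOn_of_continuous hf) _ hc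
  refine ⟨η, f z₀ / 2, hη, hc, fun p hp z hz hd => ?_⟩
  have h1 := h p hp z (hZS hz) hd
  rw [Real.dist_eq, abs_lt] at h1
  have h2 : f z₀ ≤ f z := hmin hz
  linarith

/-- Positivity on a compact face of the parameter set extends to a neighbourhood by uniform
continuity. The face is `δ = 0` when `x` vanishes and `δ = r = 0` otherwise. -/
lemma exists_le_re_prod_diagIntegral {d : ℕ} {α : Fin d → ℝ} (hα : ∀ ℓ, 0 ≤ α ℓ)
    (x : Fin d → ℝ) (σ : ℝ) (hq : 0 < q) (hq1 : q ≤ 1) (ha₀ : 0 < a₀) :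
    ∃ η c : ℝ, 0 < η ∧ 0 < c ∧ ∀ p ∈ diagParam a₀ a₁ q, p.1 < η →
      ((∀ ℓ, x ℓ = 0) ∨ |p.2.1| < η) → c ≤ (∏ ℓ, diagIntegral σ (α ℓ) (x ℓ) p).re := by
  have hS := isCompact_diagParam (a₁ := a₁) hq ha₀
  have hf : ContinuousOn (fun p => (∏ ℓ, diagIntegral σ (α ℓ) (x ℓ) p).re)
      (diagParam a₀ a₁ q) :=
    Complex.continuous_re.comp_continuousOn
      (continuousOn_finsetProd _ fun ℓ _ => continuousOn_diagIntegral (hα ℓ) hq hq1 ha₀)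
  have hprod : ∀ g : Fin d → ℂ, (∀ ℓ, ∃ r : ℝ, 0 < r ∧ g ℓ = r) → 0 < (∏ ℓ, g ℓ).re := by
    intro g hg
    choose r hr hgr using hg
    simp only [hgr, ← Complex.ofReal_prod, Complex.ofReal_re]
    exact Finset.prod_pos fun ℓ _ => hr ℓ
  by_cases hx : ∀ ℓ, x ℓ = 0
  · obtain ⟨η, c, hη, hc, h⟩ := exists_le_near hS hf
      (Z := diagParam a₀ a₁ q ∩ {p | p.1 = 0})
      (hS.inter_right (isClosed_eq continuous_fst continuous_const)) Set.inter_subset_left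
      (fun p hp => hprod _ fun ℓ => by
        rw [hx ℓ]
        exact diagIntegral_pos_of_eq_zero (hα ℓ) hq hq1 ha₀ hp.1 hp.2)
    refine ⟨η, c, hη, hc, fun p hp hp1 _ => h p hp (0, p.2) ⟨⟨le_rfl, zero_le_one, hp.2.2⟩, rfl⟩ ?_⟩
    rw [Prod.dist_eq, dist_self, max_lt_iff, Real.dist_eq, sub_zero, abs_of_nonneg hp.1]
    exact ⟨hp1, hη⟩
  · obtain ⟨η, c, hη, hc, h⟩ := exists_le_near hS hf
      (Z := diagParam a₀ a₁ q ∩ {p | p.1 = 0 ∧ p.2.1 = 0})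
      (hS.inter_right ((isClosed_eq continuous_fst continuous_const).inter
        (isClosed_eq (by fun_prop) continuous_const))) Set.inter_subset_left
      (fun p hp => hprod _ fun ℓ => by
        obtain ⟨⟨_, _, h3, _⟩, h1, h2⟩ := hp
        obtain ⟨δ, r, A⟩ := p
        simp only at h1 h2 h3
        rw [h1, h2]
        exact diagIntegral_pos (hα ℓ) (ha₀.trans_le h3))
    refine ⟨η, c, hη, hc, fun p hp hp1 hp2 => h p hp (0, 0, p.2.2)
      ⟨⟨le_rfl, zero_le_one, hp.2.2.1, hp.2.2.2.1, ?_⟩, rfl, rfl⟩ ?_⟩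
    · exact (by simp : ((0 : ℝ)) ^ 2 ≤ 0).trans ((sq_nonneg _).trans hp.2.2.2.2)
    · rw [Prod.dist_eq, Prod.dist_eq, dist_self, max_lt_iff, max_lt_iff, Real.dist_eq,
        Real.dist_eq, sub_zero, sub_zero, abs_of_nonneg hp.1]
      exact ⟨hp1, hp2.resolve_left hx, hη⟩

/-- Change of variables near the diagonal. -/
lemma integral_quadIntegrand_eq (ha : 0 ≤ a) {A B C δ : ℝ} (hB : 0 < B) (hq : 0 < q)
    (hq1 : q ≤ 1) (ha₀ : 0 < a₀) (hδ : 0 < δ) (hδ2 : δ ^ 2 = A + B - 2 * C)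
    {q' : ℝ} (hq' : 0 < q') (hq1' : q' ≤ 1) (h : C ^ 2 ≤ (1 - q') * (A * B))
    (hp : (δ, (A - C) / δ, A) ∈ diagParam a₀ a₁ q) :
    ∫ p, quadIntegrand σ a x A B C p =
      ((δ ^ (-(2 * a + 1)) : ℝ) : ℂ) * diagIntegral σ a x (δ, (A - C) / δ, A) := by
  have hA : 0 < A := ha₀.trans_le hp.2.2.1
  -- Homogeneity of the two symbols gives `δ^{-2a}`; the Jacobian below supplies the remaining
  -- `δ⁻¹`. The choice of `δ` normalizes the coefficient of `u²` to one.
  have hpt : ∀ u w : ℝ, quadIntegrand σ a x A B C (w + δ⁻¹ * u, δ⁻¹ * u) =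
      ((δ ^ (-(2 * a)) : ℝ) : ℂ) * diagIntegrand σ a x (δ, (A - C) / δ, A) (w, u) := by
    intro u w
    have e1 : w + δ⁻¹ * u = δ⁻¹ * (u + δ * w) := by field_simp; ring
    have e2 : A * (w + δ⁻¹ * u) ^ 2 - 2 * C * ((w + δ⁻¹ * u) * (δ⁻¹ * u)) + B * (δ⁻¹ * u) ^ 2 =
        A * w ^ 2 + 2 * ((A - C) / δ) * (w * u) + u ^ 2 := by
      have : u ^ 2 = (A + B - 2 * C) * (δ⁻¹ * u) ^ 2 := by
        rw [← hδ2]; field_simp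
      rw [this]
      field_simp
      ring
    have e3 : δ ^ (-(2 * a)) = (δ⁻¹) ^ a * (δ⁻¹) ^ a := by
      rw [← Real.rpow_add (inv_pos.2 hδ), Real.inv_rpow hδ.le, ← Real.rpow_neg hδ.le, two_mul]
    simp only [quadIntegrand, diagIntegrand]
    rw [e2, e3, add_sub_cancel_right, fracSymbol_mul_of_pos (inv_pos.2 hδ), e1,
      fracSymbol_mul_of_pos (inv_pos.2 hδ), map_mul, Complex.conj_ofReal]
    push_cast
    ring
  have hint := integrable_quadIntegrand (σ := σ) (x := x) ha hA hB hq' hq1' h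
  have hint2 := integrable_diagIntegrand (σ := σ) (x := x) ha hq hq1 ha₀ hp
  calc ∫ p, quadIntegrand σ a x A B C p
      = ∫ z : ℝ, ∫ y : ℝ, quadIntegrand σ a x A B C (y, z) := integral_prod_symm _ hint
    _ = ∫ z : ℝ, ∫ w : ℝ, quadIntegrand σ a x A B C (w + z, z) := by
        refine integral_congr_ae (ae_of_all _ fun z => ?_)
        exact (integral_add_right_eq_self (fun y => quadIntegrand σ a x A B C (y, z)) z).symm
    _ = |δ⁻¹| • ∫ u : ℝ, ∫ w : ℝ, quadIntegrand σ a x A B C (w + δ⁻¹ * u, δ⁻¹ * u) := by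
        have h1 := Measure.integral_comp_mul_left
          (fun z : ℝ => ∫ w : ℝ, quadIntegrand σ a x A B C (w + z, z)) δ⁻¹
        rw [h1, smul_smul, inv_inv, ← abs_mul, inv_mul_cancel₀ hδ.ne', abs_one, one_smul]
    _ = |δ⁻¹| • (((δ ^ (-(2 * a)) : ℝ) : ℂ) *
          ∫ u : ℝ, ∫ w : ℝ, diagIntegrand σ a x (δ, (A - C) / δ, A) (w, u)) := by
        simp only [hpt, integral_const_mul]
    _ = _ := by
        rw [diagIntegral, Measure.volume_eq_prod, integral_prod_symm _ hint2, abs_of_pos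
          (inv_pos.2 hδ), Complex.real_smul, ← mul_assoc, ← Complex.ofReal_mul, neg_add,
          Real.rpow_add hδ, Real.rpow_neg_one, mul_comm δ⁻¹]

end DiagIntegral

/-! ### Two-sided control of the covariance, near and off the diagonal -/

/-- The product over the components of the covariances of `fracHeat`, for a Gaussian pair with
covariance matrix `!![A, C; C, B]`. -/
def prodQuad {d : ℕ} (σ : ℝ) (α x : Fin d → ℝ) (A B C : ℝ) : ℂ :=
  ∏ ℓ, ((1 / (2 * Real.pi) : ℂ) ^ 2 * ∫ p : ℝ × ℝ, quadIntegrand σ (α ℓ) (x ℓ) A B C p)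

section Estimates

variable {R : ℝ≥0 → ℝ≥0 → ℝ} {H κ K T : ℝ}

lemma CovBounds.sq_le (hR : CovBounds R H κ K) (hκ : 0 < κ) {t s : ℝ≥0} (ht : 0 < t)
    (hs : 0 < s) : R t s ^ 2 ≤ R t t * R s s := by
  have h1 := hR.le_det t s ht hs
  have h2 : 0 ≤ κ * min (|(t : ℝ) - s| ^ (2 * H)) ((t : ℝ) ^ (2 * H)) * R s s :=
    mul_nonneg (mul_nonneg hκ.le (le_min (by positivity) (by positivity))) (hR.diag_nonneg s)
  linarith

/-- The variance at `t` is compared with that at the reference time `T` through the increment bound;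
Young's inequality absorbs half of `R t t` from the cross term. -/
lemma CovBounds.exists_diag_le (hR : CovBounds R H κ K) (hκ : 0 < κ) (hK : 0 < K) (hH : 0 < H)
    (hT : 0 < T) : ∃ M : ℝ, 0 < M ∧ ∀ t : ℝ≥0, 0 < t → (t : ℝ) ≤ T → R t t ≤ M := by
  set τ : ℝ≥0 := ⟨T, hT.le⟩ with hτ
  have hτ0 : 0 < τ := hT
  have hpos : 0 < R τ τ :=
    (mul_pos hκ (Real.rpow_pos_of_pos hT (2 * H))).trans_le (hR.le_diag τ hτ0)
  refine ⟨2 * (K * T ^ (2 * H)) + 2 * R τ τ, by positivity, fun t ht htT => ?_⟩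
  have h1 := hR.incr_le t τ
  have h2 := hR.sq_le hκ ht hτ0
  have h3 : |(t : ℝ) - τ| ^ (2 * H) ≤ T ^ (2 * H) := by
    refine Real.rpow_le_rpow (abs_nonneg _) ?_ (by positivity)
    rw [abs_le]
    have := t.coe_nonneg
    have : (τ : ℝ) = T := rfl
    constructor <;> linarith
  have h4 : 2 * R t τ ≤ 1 / 2 * R t t + 2 * R τ τ := by
    have h5 := hR.diag_nonneg t
    have := abs_le_of_sq_le_sq (a := 2 * R t τ) (b := 1 / 2 * R t t + 2 * R τ τ)
      (by nlinarith [sq_nonneg (1 / 2 * R t t - 2 * R τ τ)]) (by positivity)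
    exact (abs_le.1 this).2
  have h6 := mul_le_mul_of_nonneg_left h3 hK.le
  linarith

lemma rpow_neg_le_of_le {a b p : ℝ} (ha : 0 < a) (h : a ≤ b) (hp : 0 ≤ p) :
    b ^ (-p) ≤ a ^ (-p) :=
  Real.rpow_le_rpow_of_nonpos ha h (by linarith)

/-- Away from the diagonal, the covariance is at most that of the value at time `s` alone. -/
lemma CovBounds.exists_norm_prodQuad_le (hR : CovBounds R H κ K) (hκ : 0 < κ) (hK : 0 < K)
    (hH : 0 < H) (hT : 0 < T) {θ : ℝ} (hθ : 0 < θ) {d : ℕ} {α : Fin d → ℝ} (hα : ∀ ℓ, 0 ≤ α ℓ)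
    (σ : ℝ) (x : Fin d → ℝ) :
    ∃ D : ℝ, 0 ≤ D ∧ ∀ (t s : ℝ≥0) (ε : ℝ), T / 2 ≤ t → (t : ℝ) ≤ T → 0 < s → (s : ℝ) ≤ T →
      θ ≤ |(t : ℝ) - s| → 0 < ε →
      ‖prodQuad σ α x (R t t + ε) (R s s + ε) (R t s)‖ ≤
        D * ((s : ℝ) ^ (2 * H) + ε) ^ (-((∑ ℓ, α ℓ + d) / 2)) := by
  obtain ⟨M, hM, hRM⟩ := hR.exists_diag_le hκ hK hH hT
  set m := κ * min (θ ^ (2 * H)) ((T / 2) ^ (2 * H)) with hm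
  have hm0 : 0 < m := by positivity
  -- Chosen so that `q * R t t ≤ m`, which turns the determinant bound into a correlation bound
  -- uniform in `t`, `s` and `ε`.
  set q := min 1 (m / M) with hq
  have hq0 : 0 < q := by positivity
  have hq1 : q ≤ 1 := min_le_left _ _
  set a₀ := κ * (T / 2) ^ (2 * H) with ha₀
  have ha₀0 : 0 < a₀ := by positivity
  set k := min κ 1 with hk
  have hk0 : 0 < k := by positivity
  set c : Fin d → ℝ := fun ℓ => ‖(1 / (2 * Real.pi) : ℂ) ^ 2‖ *
    (((q / 2) ^ (-((α ℓ + 1) / 2)) * absMoment (α ℓ)) ^ 2 *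
      (a₀ ^ (-((α ℓ + 1) / 2)) * k ^ (-((α ℓ + 1) / 2)))) with hc
  refine ⟨∏ ℓ, c ℓ, Finset.prod_nonneg fun ℓ _ => by simp only [hc]; positivity,
    fun t s ε ht htT hs hsT hts hε => ?_⟩
  have ht0 : (0 : ℝ) < t := by linarith
  have ht0' : 0 < t := ht0
  have hs0 : (0 : ℝ) < s := hs
  have hsp : 0 < (s : ℝ) ^ (2 * H) := by positivity
  have hA : a₀ ≤ R t t := by
    refine le_trans ?_ (hR.le_diag t ht0')
    simp only [ha₀]
    gcongr
  have hB : κ * (s : ℝ) ^ (2 * H) ≤ R s s := hR.le_diag s hs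
  have hB0 : 0 < R s s := lt_of_lt_of_le (by positivity) hB
  have hB' : k * ((s : ℝ) ^ (2 * H) + ε) ≤ R s s + ε := by
    have h1 : k * (s : ℝ) ^ (2 * H) ≤ κ * (s : ℝ) ^ (2 * H) := by
      gcongr
      exact min_le_left _ _
    have h2 : k * ε ≤ 1 * ε := by
      gcongr
      exact min_le_right _ _
    linarith
  have hdet : R t s ^ 2 ≤ (1 - q) * ((R t t + ε) * (R s s + ε)) := by
    have h1 := hR.le_det t s ht0' hs
    have h2 : m ≤ κ * min (|(t : ℝ) - s| ^ (2 * H)) ((t : ℝ) ^ (2 * H)) := by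
      simp only [hm]
      gcongr
    have h3 : q * (R t t * R s s) ≤ m * R s s := by
      have h4 : q * R t t ≤ m / M * M := by
        have h5 := hRM t ht0' htT
        have h6 : q ≤ m / M := min_le_right _ _
        have := hA.trans' ha₀0.le
        gcongr
      rw [div_mul_cancel₀ _ hM.ne'] at h4
      nlinarith
    have h4 : m * R s s ≤ R t t * R s s - R t s ^ 2 := by
      refine le_trans ?_ h1
      gcongr
    have h5 : R t t * R s s ≤ (R t t + ε) * (R s s + ε) := by
      have := hA.trans' ha₀0.le
      gcongr <;> linarith
    nlinarith [mul_le_mul_of_nonneg_left h5 (sub_nonneg.2 hq1)]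
  have hbase : 0 < (s : ℝ) ^ (2 * H) + ε := by positivity
  have hfac : ∀ ℓ, ‖(1 / (2 * Real.pi) : ℂ) ^ 2 *
      ∫ p : ℝ × ℝ, quadIntegrand σ (α ℓ) (x ℓ) (R t t + ε) (R s s + ε) (R t s) p‖ ≤
      c ℓ * ((s : ℝ) ^ (2 * H) + ε) ^ (-((α ℓ + 1) / 2)) := by
    intro ℓ
    have hp : 0 ≤ (α ℓ + 1) / 2 := by have := hα ℓ; positivity
    rw [norm_mul, hc]
    simp only
    rw [mul_assoc, mul_assoc, mul_assoc]
    refine mul_le_mul_of_nonneg_left ?_ (norm_nonneg _)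
    refine (norm_integral_quadIntegrand_le (hα ℓ) (by linarith) (by linarith) hq0 hq1 hdet).trans ?_
    refine mul_le_mul_of_nonneg_left ?_ (by positivity)
    refine mul_le_mul (rpow_neg_le_of_le ha₀0 (by linarith) hp) ?_ (by positivity) (by positivity)
    rw [← Real.mul_rpow hk0.le hbase.le]
    exact rpow_neg_le_of_le (by positivity) hB' hp
  rw [prodQuad, norm_prod]
  refine (Finset.prod_le_prod (fun ℓ _ => norm_nonneg _) fun ℓ _ => hfac ℓ).trans_eq ?_
  rw [Finset.prod_mul_distrib, ← Real.rpow_sum_of_pos hbase, Finset.sum_neg_distrib,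
    ← Finset.sum_div, Finset.sum_add_distrib]
  simp

lemma increment_nonneg {a b c : ℝ} (ha : 0 ≤ a) (hb : 0 ≤ b) (hc : c ^ 2 ≤ a * b) :
    0 ≤ a - 2 * c + b := by
  have := abs_le_of_sq_le_sq (a := 2 * c) (b := a + b)
    (by nlinarith [sq_nonneg (a - b)]) (add_nonneg ha hb)
  linarith [(abs_le.1 this).2]

/-- Decay of the covariance of increments in terms of the covariance function. -/
def CovDecay (R : ℝ≥0 → ℝ≥0 → ℝ) : Prop :=
  ∃ β : ℝ → ℝ, Tendsto β atTop (𝓝 0) ∧ ∀ (s t : ℝ≥0) (γ : ℝ), 0 < s → s < t → 1 < γ →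
    ((t : ℝ) - s) / s ≤ 1 / γ →
    |R t s - R s s| ≤ β γ * Real.sqrt (R t t - 2 * R t s + R s s) * Real.sqrt (R s s)

lemma exists_mul_rpow_le (K : ℝ) {p ρ : ℝ} (hp : 0 < p) (hK : 0 < K) (hρ : 0 < ρ) :
    ∃ θ : ℝ, 0 < θ ∧ ∀ u, 0 ≤ u → u ≤ θ → K * u ^ p ≤ ρ := by
  refine ⟨(ρ / K) ^ p⁻¹, by positivity, fun u hu hle => ?_⟩
  have h := Real.rpow_le_rpow hu hle hp.le
  rw [← Real.rpow_mul (by positivity), inv_mul_cancel₀ hp.ne', Real.rpow_one] at h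
  calc K * u ^ p ≤ K * (ρ / K) := by gcongr
    _ = ρ := by field_simp

/-- The decay of the covariance of increments makes the normalized covariance of `Y_t - Y_s` and
`Y_t` small near the diagonal. -/
lemma CovBounds.exists_abs_div_lt (hR : CovBounds R H κ K) (hκ : 0 < κ) (hK : 0 < K)
    (hH : 0 < H) (hT : 0 < T) (hdec : CovDecay R) {η : ℝ} (hη : 0 < η) :
    ∃ θ ε₀ : ℝ, 0 < θ ∧ 0 < ε₀ ∧ ∀ (t s : ℝ≥0) (ε : ℝ), T / 2 ≤ t → (t : ℝ) ≤ T → 0 < s →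
      (s : ℝ) ≤ T → |(t : ℝ) - s| ≤ θ → 0 < ε → ε ≤ ε₀ →
      |(R t t + ε - R t s) / Real.sqrt (R t t - 2 * R t s + R s s + 2 * ε)| < η := by
  obtain ⟨M, hM, hRM⟩ := hR.exists_diag_le hκ hK hH hT
  obtain ⟨β, hβ, hβ'⟩ := hdec
  have hsM : 0 < Real.sqrt M := Real.sqrt_pos.2 hM
  obtain ⟨γ, hγβ, hγ⟩ := (((hβ.mul_const (Real.sqrt M)).eventually_lt_const (u := η / 4)
    (by simpa using (by positivity : 0 < η / 4))).and (eventually_gt_atTop (1 : ℝ))).exists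
  obtain ⟨θ, hθ, hθ'⟩ := exists_mul_rpow_le K (p := 2 * H) (ρ := (η / 4) ^ 2) (by positivity) hK
    (by positivity)
  -- The second term forces `s ≥ T / 4` and makes the relative increment at most `1 / γ`. The
  -- numerator below has at most three pieces, each bounded by `η / 4 * δ`.
  refine ⟨min θ (T / 4 / γ), (η / 4) ^ 2, by positivity, by positivity,
    fun t s ε ht htT hs hsT hts hε hεη => ?_⟩
  have hts1 := hts.trans (min_le_left _ _)
  have hts2 := hts.trans (min_le_right _ _)
  have hγ0 : 0 < γ := by linarith
  have hs4 : T / 4 ≤ s := by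
    have h1 : T / 4 / γ ≤ T / 4 := div_le_self (by positivity) hγ.le
    have := (abs_le.1 (hts2.trans h1)).2
    linarith
  have ht0 : (0 : ℝ) < t := by linarith
  have ht0' : 0 < t := ht0
  set v := R t t - 2 * R t s + R s s with hv
  have hv0 : 0 ≤ v :=
    increment_nonneg (hR.diag_nonneg t) (hR.diag_nonneg s) (hR.sq_le hκ ht0' hs)
  have hvη : Real.sqrt v ≤ η / 4 := by
    rw [Real.sqrt_le_left (by positivity)]
    exact (hR.incr_le t s).trans (hθ' _ (abs_nonneg _) hts1)
  have hεη' : Real.sqrt ε ≤ η / 4 := by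
    rwa [Real.sqrt_le_left (by positivity)]
  set δ := Real.sqrt (v + 2 * ε) with hδ
  have hδ0 : 0 < δ := Real.sqrt_pos.2 (by positivity)
  have hvδ : Real.sqrt v ≤ δ := Real.sqrt_le_sqrt (by linarith)
  have hεδ : Real.sqrt ε ≤ δ := Real.sqrt_le_sqrt (by linarith)
  have hratio : ∀ a b : ℝ≥0, T / 4 ≤ a → |(b : ℝ) - a| ≤ T / 4 / γ →
      ((b : ℝ) - a) / a ≤ 1 / γ := by
    intro a b ha hab
    have ha0 : (0 : ℝ) < a := by linarith
    rw [div_le_iff₀ ha0]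
    calc (b : ℝ) - a ≤ T / 4 / γ := (le_abs_self _).trans hab
      _ = 1 / γ * (T / 4) := by ring
      _ ≤ _ := by gcongr
  -- `CovDecay` does not record the sign of `β`; a negative value makes the right-hand side of the
  -- decay bound nonpositive, which is harmless.
  have hfin : ∀ w, 0 ≤ w → w ≤ M → β γ * Real.sqrt v * Real.sqrt w ≤ η / 4 * δ ∨ β γ < 0 := by
    intro w _ hw
    rcases lt_or_ge (β γ) 0 with h | h
    · exact Or.inr h
    · refine Or.inl ?_
      calc β γ * Real.sqrt v * Real.sqrt w ≤ β γ * δ * Real.sqrt M := by gcongr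
        _ = β γ * Real.sqrt M * δ := by ring
        _ ≤ _ := by gcongr
  have hfin' : ∀ (z w : ℝ), 0 ≤ w → w ≤ M → |z| ≤ β γ * Real.sqrt v * Real.sqrt w →
      |z| ≤ η / 4 * δ := by
    intro z w hw0 hw hz
    rcases hfin w hw0 hw with h | h
    · exact hz.trans h
    · have : β γ * Real.sqrt v * Real.sqrt w ≤ 0 :=
        mul_nonpos_of_nonpos_of_nonneg (mul_nonpos_of_nonpos_of_nonneg h.le (Real.sqrt_nonneg _))
          (Real.sqrt_nonneg _)
      linarith [(by positivity : 0 ≤ η / 4 * δ)]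
  have hvv : v ≤ η / 4 * δ := by
    nth_rewrite 1 [← Real.mul_self_sqrt hv0]
    gcongr
  have hεε : ε ≤ η / 4 * δ := by
    nth_rewrite 1 [← Real.mul_self_sqrt hε.le]
    gcongr
  have key : |R t t - R t s| ≤ η / 4 * δ + η / 4 * δ := by
    rcases lt_trichotomy s t with h | h | h
    · have h1 := hfin' _ _ (hR.diag_nonneg s) (hRM s hs hsT)
        (hβ' s t γ hs h hγ (hratio s t hs4 hts2))
      have h2 : R t t - R t s = v + (R t s - R s s) := by rw [hv]; ring
      rw [h2]
      exact (abs_add_le _ _).trans (add_le_add (by rwa [abs_of_nonneg hv0]) h1)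
    · rw [h]
      simp only [sub_self, abs_zero]
      positivity
    · have h1 := hβ' t s γ ht0' h hγ (hratio t s (by linarith) (by rwa [abs_sub_comm]))
      rw [hR.symm s t] at h1
      have h3 : R s s - 2 * R t s + R t t = v := by rw [hv]; ring
      rw [h3] at h1
      have h2 := hfin' _ _ (hR.diag_nonneg t) (hRM t ht0' htT) h1
      rw [abs_sub_comm]
      exact h2.trans (le_add_of_nonneg_left (by positivity))
  rw [abs_div, abs_of_pos hδ0, div_lt_iff₀ hδ0]
  have h1 : R t t + ε - R t s = (R t t - R t s) + ε := by ring
  rw [h1]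
  have h2 := abs_add_le (R t t - R t s) ε
  rw [abs_of_pos hε] at h2
  nlinarith

/-- The determinant bound survives adding `ε` to both variances: the determinant gains `ε(a + b) +
ε²`, and `q ≤ 1/4` with `a - 2c + b ≤ 2a + 2b` keeps the gain on the left below that. -/
lemma det_add_ge {a b c q ε : ℝ} (ha : 0 ≤ a) (hb : 0 ≤ b) (hε : 0 ≤ ε) (hc : c ^ 2 ≤ a * b)
    (hq4 : q ≤ 1 / 4) (hdet : q * (a * (a - 2 * c + b)) ≤ a * b - c ^ 2) :
    q * ((a + ε) * (a - 2 * c + b + 2 * ε)) ≤ (a + ε) * (b + ε) - c ^ 2 := by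
  have hv0 := increment_nonneg ha hb hc
  have hv2 : a - 2 * c + b ≤ 2 * a + 2 * b := by
    have := increment_nonneg (c := -c) ha hb (by simpa using hc)
    linarith
  have h1 : q * (2 * (a * ε) + ε * (a - 2 * c + b) + 2 * ε ^ 2) ≤
      1 / 4 * (2 * (a * ε) + ε * (a - 2 * c + b) + 2 * ε ^ 2) :=
    mul_le_mul_of_nonneg_right hq4 (by positivity)
  have h2 : ε * (a - 2 * c + b) ≤ ε * (2 * a + 2 * b) := mul_le_mul_of_nonneg_left hv2 hε
  have h3 : 0 ≤ ε * b := mul_nonneg hε hb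
  have h4 := sq_nonneg ε
  linarith

/-- Rests on the identity `A δ² - (A - C)² = A B - C²` for `δ² = A + B - 2C`: the constraint on `r =
(A - C)/δ` is exactly a determinant bound. -/
lemma mem_diagParam {a b c q ε δ a₀ M : ℝ} (ha : a₀ ≤ a) (haM : a ≤ M)
    (hε : 0 < ε) (hε1 : ε ≤ 1) (hδ0 : 0 < δ) (hδ1 : δ ≤ 1)
    (hδ : δ ^ 2 = a - 2 * c + b + 2 * ε)
    (hdet : q * ((a + ε) * (a - 2 * c + b + 2 * ε)) ≤ (a + ε) * (b + ε) - c ^ 2) :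
    (δ, (a + ε - c) / δ, a + ε) ∈ diagParam a₀ (M + 1) q := by
  refine ⟨hδ0.le, hδ1, by simp only; linarith, by simp only; linarith, ?_⟩
  simp only
  rw [div_pow, div_le_iff₀ (by positivity), hδ]
  nlinarith

/-- Change of variables near the diagonal, for the product over the components. -/
lemma prodQuad_eq {d : ℕ} {α : Fin d → ℝ} (hα : ∀ ℓ, 0 ≤ α ℓ) (σ : ℝ) (x : Fin d → ℝ)
    {A B C δ q a₀ a₁ : ℝ} (hB : 0 < B) (hq : 0 < q) (hq1 : q ≤ 1) (ha₀ : 0 < a₀) (hδ : 0 < δ)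
    (hδ2 : δ ^ 2 = A + B - 2 * C) (hdet : 0 < A * B - C ^ 2)
    (hp : (δ, (A - C) / δ, A) ∈ diagParam a₀ a₁ q) :
    prodQuad σ α x A B C =
      (((1 / (2 * Real.pi)) ^ (2 * d) * δ ^ (-(2 * (∑ ℓ, α ℓ + (d : ℝ) / 2))) : ℝ) : ℂ) *
        ∏ ℓ, diagIntegral σ (α ℓ) (x ℓ) (δ, (A - C) / δ, A) := by
  have hAB : 0 < A * B := by nlinarith [sq_nonneg C]
  have hq'1 : (A * B - C ^ 2) / (A * B) ≤ 1 := by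
    rw [div_le_one hAB]
    nlinarith [sq_nonneg C]
  have hq'C : C ^ 2 ≤ (1 - (A * B - C ^ 2) / (A * B)) * (A * B) := by
    rw [sub_mul, div_mul_cancel₀ _ hAB.ne']
    linarith
  have h1 : ∀ ℓ, (1 / (2 * Real.pi) : ℂ) ^ 2 *
      ∫ p : ℝ × ℝ, quadIntegrand σ (α ℓ) (x ℓ) A B C p =
      (((1 / (2 * Real.pi)) ^ 2 * δ ^ (-(2 * α ℓ + 1)) : ℝ) : ℂ) *
        diagIntegral σ (α ℓ) (x ℓ) (δ, (A - C) / δ, A) := by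
    intro ℓ
    rw [integral_quadIntegrand_eq (hα ℓ) hB hq hq1 ha₀ hδ hδ2 (div_pos hdet hAB) hq'1 hq'C hp,
      Complex.ofReal_mul, mul_assoc]
    push_cast
    rfl
  rw [prodQuad, Finset.prod_congr rfl fun ℓ _ => h1 ℓ, Finset.prod_mul_distrib,
    ← Complex.ofReal_prod, Finset.prod_mul_distrib, ← Real.rpow_sum_of_pos hδ,
    Finset.sum_neg_distrib, Finset.sum_add_distrib, ← Finset.mul_sum]
  congr 3
  · simp [pow_mul]
  · simp only [Finset.sum_const, Finset.card_univ, Fintype.card_fin, nsmul_eq_mul, mul_one]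
    ring_nf

/-- Near the diagonal, the covariance is bounded below by a negative power of the variance of the
increment. -/
lemma CovBounds.exists_le_re_prodQuad (hR : CovBounds R H κ K) (hκ : 0 < κ) (hK : 0 < K)
    (hH : 0 < H) (hT : 0 < T) {d : ℕ} {α : Fin d → ℝ} (hα : ∀ ℓ, 0 ≤ α ℓ)
    (σ : ℝ) (x : Fin d → ℝ) (hx : (∀ ℓ, x ℓ = 0) ∨ CovDecay R) :
    ∃ θ ε₀ c : ℝ, 0 < θ ∧ θ ≤ T / 4 ∧ 0 < ε₀ ∧ 0 < c ∧ ∀ (t s : ℝ≥0) (ε : ℝ), T / 2 ≤ t →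
      (t : ℝ) ≤ T → 0 < s → (s : ℝ) ≤ T → |(t : ℝ) - s| ≤ θ → 0 < ε → ε ≤ ε₀ →
      c * (|(t : ℝ) - s| ^ (2 * H) + ε) ^ (-(∑ ℓ, α ℓ + d / 2)) ≤
        (prodQuad σ α x (R t t + ε) (R s s + ε) (R t s)).re := by
  obtain ⟨M, hM, hRM⟩ := hR.exists_diag_le hκ hK hH hT
  -- The ratio `κ / K` compares local nondeterminism with the upper bound on increments; `1 / 4` is
  -- what `det_add_ge` needs.
  obtain ⟨q, hq0, hq4, hqK⟩ : ∃ q : ℝ, 0 < q ∧ q ≤ 1 / 4 ∧ q * K ≤ κ := by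
    refine ⟨min (κ / K) (1 / 4), by positivity, min_le_right _ _, ?_⟩
    have := mul_le_mul_of_nonneg_right (min_le_left (κ / K) (1 / 4)) hK.le
    rwa [div_mul_cancel₀ _ hK.ne'] at this
  obtain ⟨a₀, ha₀0, ha₀⟩ : ∃ a₀ : ℝ, 0 < a₀ ∧ ∀ t : ℝ≥0, T / 2 ≤ t → a₀ ≤ R t t := by
    refine ⟨κ * (T / 2) ^ (2 * H), by positivity, fun t ht => ?_⟩
    refine le_trans ?_ (hR.le_diag t (NNReal.coe_pos.1 (by linarith)))
    gcongr
  obtain ⟨η, c, hη, hc, hlow⟩ := exists_le_re_prod_diagIntegral (a₁ := M + 1) hα x σ hq0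
    (by linarith) ha₀0
  obtain ⟨ν, hν0, hνη, hν1⟩ : ∃ ν : ℝ, 0 < ν ∧ ν ≤ η ∧ ν ≤ 1 :=
    ⟨min η 1, by positivity, min_le_left _ _, min_le_right _ _⟩
  -- Together with `ε ≤ ν² / 8` this gives `δ² ≤ ν² / 2 < ν²`.
  obtain ⟨θ₁, hθ₁, hθ₁'⟩ := exists_mul_rpow_le K (p := 2 * H) (ρ := ν ^ 2 / 4) (by positivity) hK
    (by positivity)
  have hcor : ∃ θ ε₀ : ℝ, 0 < θ ∧ 0 < ε₀ ∧ ∀ (t s : ℝ≥0) (ε : ℝ), T / 2 ≤ t → (t : ℝ) ≤ T →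
      0 < s → (s : ℝ) ≤ T → |(t : ℝ) - s| ≤ θ → 0 < ε → ε ≤ ε₀ → (∀ ℓ, x ℓ = 0) ∨
      |(R t t + ε - R t s) / Real.sqrt (R t t - 2 * R t s + R s s + 2 * ε)| < η := by
    rcases hx with hx | hx
    · exact ⟨1, 1, one_pos, one_pos, fun _ _ _ _ _ _ _ _ _ _ => Or.inl hx⟩
    · obtain ⟨θ, ε₀, h1, h2, h3⟩ := hR.exists_abs_div_lt hκ hK hH hT hx hη
      exact ⟨θ, ε₀, h1, h2, fun t s ε i1 i2 i3 i4 i5 i6 i7 => Or.inr (h3 t s ε i1 i2 i3 i4 i5 i6 i7)⟩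
  obtain ⟨θ₂, ε₂, hθ₂, hε₂, hcor⟩ := hcor
  obtain ⟨N, hN0, hNK, hN2⟩ : ∃ N : ℝ, 0 < N ∧ K ≤ N ∧ 2 ≤ N :=
    ⟨max K 2, by positivity, le_max_left _ _, le_max_right _ _⟩
  obtain ⟨e, he⟩ : ∃ e : ℝ, e = ∑ ℓ, α ℓ + (d : ℝ) / 2 := ⟨_, rfl⟩
  have he0 : 0 ≤ e := he ▸ add_nonneg (Finset.sum_nonneg fun ℓ _ => hα ℓ) (by positivity)
  rw [← he]
  refine ⟨min (T / 4) (min θ₁ θ₂), min (min 1 (ν ^ 2 / 8)) ε₂,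
    (1 / (2 * Real.pi)) ^ (2 * d) * (N ^ (-e) * c), by positivity, min_le_left _ _,
    by positivity, by positivity, fun t s ε ht htT hs hsT hts hε hεε => ?_⟩
  have hts4 := hts.trans (min_le_left _ _)
  have hts1 := hts.trans ((min_le_right _ _).trans (min_le_left _ _))
  have hts2 := hts.trans ((min_le_right _ _).trans (min_le_right _ _))
  have hε1 := hεε.trans ((min_le_left _ _).trans (min_le_left _ _))
  have hεν := hεε.trans ((min_le_left _ _).trans (min_le_right _ _))
  have hcor' := hcor t s ε ht htT hs hsT hts2 hε (hεε.trans (min_le_right _ _))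
  have hs4 : T / 4 ≤ s := by
    have := (abs_le.1 hts4).2
    linarith
  have ht0 : 0 < t := NNReal.coe_pos.1 (by linarith)
  have hvK := hR.incr_le t s
  have ha := hRM t ht0 htT
  have hb0 := hR.diag_nonneg s
  have hA := ha₀ t ht
  have hcs := hR.sq_le hκ ht0 hs
  have hv0 := increment_nonneg (hR.diag_nonneg t) hb0 hcs
  have hdet : q * (R t t * (R t t - 2 * R t s + R s s)) ≤ R t t * R s s - R t s ^ 2 := by
    -- Conditioning `s` on `t`, so that `R t t` multiplies the increment; `|t - s| ≤ T / 4 ≤ s`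
    -- makes the increment the smaller term of the minimum.
    have h1 := hR.le_det s t hs ht0
    have h2 : |(s : ℝ) - t| ^ (2 * H) ≤ (s : ℝ) ^ (2 * H) :=
      Real.rpow_le_rpow (abs_nonneg _) (by rw [abs_sub_comm]; linarith) (by positivity)
    rw [min_eq_left h2, hR.symm s t, abs_sub_comm] at h1
    have h3 : q * (R t t - 2 * R t s + R s s) ≤ κ * |(t : ℝ) - s| ^ (2 * H) := by
      calc q * (R t t - 2 * R t s + R s s) ≤ q * (K * |(t : ℝ) - s| ^ (2 * H)) := by gcongr
        _ = q * K * |(t : ℝ) - s| ^ (2 * H) := by ring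
        _ ≤ _ := by gcongr
    have h4 := mul_le_mul_of_nonneg_right h3 (ha₀0.le.trans hA)
    linarith
  have hθν := hθ₁' _ (abs_nonneg ((t : ℝ) - s)) hts1
  have hu0 : 0 ≤ |(t : ℝ) - s| ^ (2 * H) := by positivity
  generalize |(t : ℝ) - s| ^ (2 * H) = u at *
  generalize R t t = a at *
  generalize R s s = b at *
  generalize R t s = C at *
  have hvε : 0 < a - 2 * C + b + 2 * ε := by positivity
  obtain ⟨δ, hδ⟩ : ∃ δ, δ = Real.sqrt (a - 2 * C + b + 2 * ε) := ⟨_, rfl⟩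
  rw [← hδ] at hcor'
  have hδ0 : 0 < δ := hδ ▸ Real.sqrt_pos.2 hvε
  have hδ2 : δ ^ 2 = a - 2 * C + b + 2 * ε := hδ ▸ Real.sq_sqrt hvε.le
  have hδν : δ < ν := by
    refine lt_of_pow_lt_pow_left₀ 2 hν0.le ?_
    rw [hδ2]
    linarith [pow_pos hν0 2]
  have hdetε := det_add_ge (ha₀0.le.trans hA) hb0 hε.le hcs hq4 hdet
  have hdet0 : 0 < (a + ε) * (b + ε) - C ^ 2 := by
    have : 0 < a := ha₀0.trans_le hA
    exact lt_of_lt_of_le (by positivity) hdetε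
  have hp := mem_diagParam hA ha hε hε1 hδ0 (hδν.le.trans hν1) hδ2 hdetε
  have hlow' := hlow _ hp (hδν.trans_le hνη) hcor'
  rw [prodQuad_eq hα σ x (by linarith) hq0 (by linarith) ha₀0 hδ0 (by rw [hδ2]; ring) hdet0 hp,
    Complex.re_ofReal_mul, ← he]
  have hδe : δ ^ (-(2 * e)) = (a - 2 * C + b + 2 * ε) ^ (-e) := by
    rw [← hδ2, ← Real.rpow_natCast, ← Real.rpow_mul hδ0.le]
    push_cast
    ring_nf
  have hbase : 0 < u + ε := by positivity
  have hle : a - 2 * C + b + 2 * ε ≤ N * (u + ε) := by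
    have h1 : K * u ≤ N * u := by gcongr
    have h2 : 2 * ε ≤ N * ε := by gcongr
    linarith
  have hpow : N ^ (-e) * (u + ε) ^ (-e) ≤ δ ^ (-(2 * e)) := by
    rw [hδe, ← Real.mul_rpow hN0.le hbase.le]
    exact rpow_neg_le_of_le hvε hle he0
  calc _ = (1 / (2 * Real.pi)) ^ (2 * d) * (N ^ (-e) * (u + ε) ^ (-e)) * c := by ring
    _ ≤ _ := by gcongr

end Estimates

/-! ### Regularized power kernels -/

section PowerKernel

/-- The regularized power kernel `(|r|^{2H} + ε)^{-p}`. -/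
def powKer (H p ε r : ℝ) : ℝ := (|r| ^ (2 * H) + ε) ^ (-p)

variable {H p ε : ℝ}

lemma powKer_nonneg (hε : 0 < ε) (r : ℝ) : 0 ≤ powKer H p ε r := by
  unfold powKer
  positivity

lemma continuous_powKer (hH : 0 < H) (hε : 0 < ε) : Continuous (powKer H p ε) := by
  have h1 : Continuous fun r : ℝ => |r| ^ (2 * H) :=
    continuous_abs.rpow_const fun _ => Or.inr (by positivity)
  exact (h1.add continuous_const).rpow_const fun r =>
    Or.inl (by positivity : 0 < |r| ^ (2 * H) + ε).ne'

/-- Beyond `r = ε^{1/(2H)}` the regularization is at most `r^{2H}`, so the kernel is at least a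
constant times `1/r`. The integral thus grows at least like `log (1/ε)`, including at the critical
exponent. -/
lemma tendsto_integral_powKer (hH : 0 < H) (hp : 1 ≤ 2 * H * p) {θ : ℝ} (hθ : 0 < θ) :
    Tendsto (fun ε => ∫ r in (0 : ℝ)..θ, powKer H p ε r) (𝓝[>] 0) atTop := by
  have hp0 : 0 ≤ p := by
    by_contra h
    nlinarith
  have hlog : Tendsto (fun ε : ℝ => 2 ^ (-p) * θ ^ (1 - 2 * H * p) *
      (Real.log θ - (2 * H)⁻¹ * Real.log ε)) (𝓝[>] 0) atTop := by
    refine Tendsto.const_mul_atTop (by positivity) ?_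
    simp only [sub_eq_add_neg, ← mul_neg]
    exact tendsto_atTop_add_const_left _ _
      ((tendsto_neg_atBot_atTop.comp Real.tendsto_log_nhdsGT_zero).const_mul_atTop (by positivity))
  refine tendsto_atTop_mono' _ ?_ hlog
  have hε1 : ∀ᶠ ε : ℝ in 𝓝[>] 0, ε < θ ^ (2 * H) :=
    mem_nhdsWithin_of_mem_nhds (Iio_mem_nhds (by positivity))
  filter_upwards [hε1, self_mem_nhdsWithin] with ε hε hε0
  have hε0 : 0 < ε := hε0
  set b := ε ^ (2 * H)⁻¹ with hb
  have hb0 : 0 < b := by positivity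
  have hbθ : b ≤ θ := by
    have := Real.rpow_le_rpow hε0.le hε.le (by positivity : 0 ≤ (2 * H)⁻¹)
    rwa [← Real.rpow_mul hθ.le, mul_inv_cancel₀ (by positivity), Real.rpow_one] at this
  have hcont := continuous_powKer (p := p) hH hε0
  have h1 : ∫ r in b..θ, powKer H p ε r ≤ ∫ r in (0 : ℝ)..θ, powKer H p ε r := by
    refine intervalIntegral.integral_mono_interval hb0.le hbθ le_rfl ?_
      (hcont.intervalIntegrable _ _)
    exact ae_of_all _ fun r => powKer_nonneg hε0 r
  refine le_trans ?_ h1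
  have h2 : Real.log θ - (2 * H)⁻¹ * Real.log ε = ∫ r in b..θ, r⁻¹ := by
    rw [integral_inv_of_pos hb0 hθ, Real.log_div hθ.ne' hb0.ne', hb, Real.log_rpow hε0]
  rw [h2, ← intervalIntegral.integral_const_mul]
  refine intervalIntegral.integral_mono_on hbθ ?_ (hcont.intervalIntegrable _ _) fun r hr => ?_
  · refine (intervalIntegral.intervalIntegrable_inv (fun r hr => ?_) continuousOn_id).const_mul _
    rw [Set.uIcc_of_le hbθ] at hr
    exact (hb0.trans_le hr.1).ne'
  · have hr0 : 0 < r := hb0.trans_le hr.1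
    have h3 : ε ≤ r ^ (2 * H) := by
      have := Real.rpow_le_rpow hb0.le hr.1 (by positivity : 0 ≤ 2 * H)
      rwa [hb, ← Real.rpow_mul hε0.le, inv_mul_cancel₀ (by positivity), Real.rpow_one] at this
    have h4 : (2 * r ^ (2 * H)) ^ (-p) ≤ powKer H p ε r := by
      unfold powKer
      rw [abs_of_pos hr0]
      exact rpow_neg_le_of_le (by positivity) (by linarith) hp0
    refine le_trans ?_ h4
    rw [Real.mul_rpow (by norm_num) (by positivity), ← Real.rpow_mul hr0.le, mul_assoc]
    refine mul_le_mul_of_nonneg_left ?_ (by positivity)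
    have h5 : r ^ (2 * H * -p) = r ^ (1 - 2 * H * p) * r⁻¹ := by
      rw [← Real.rpow_neg_one r, ← Real.rpow_add hr0]
      ring_nf
    rw [h5]
    refine mul_le_mul_of_nonneg_right ?_ (by positivity)
    exact Real.rpow_le_rpow_of_nonpos hr0 hr.2 (by linarith)

/-- A kernel with a smaller exponent is negligible. -/
lemma exists_powKer_le {p' : ℝ} (hp' : 0 ≤ p') (hlt : p' < p) {ρ : ℝ} (hρ : 0 < ρ) :
    ∃ D : ℝ, 0 ≤ D ∧ ∀ ε, 0 < ε → ∀ r, powKer H p' ε r ≤ ρ * powKer H p ε r + D := by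
  obtain ⟨a, ha, ha'⟩ := exists_mul_rpow_le 1 (sub_pos.2 hlt) one_pos hρ
  refine ⟨a ^ (-p'), by positivity, fun ε hε r => ?_⟩
  unfold powKer
  have hb : 0 < |r| ^ (2 * H) + ε := by positivity
  generalize |r| ^ (2 * H) + ε = b at hb
  rcases le_total b a with h | h
  · have h1 : b ^ (-p') = 1 * b ^ (p - p') * b ^ (-p) := by
      rw [one_mul, ← Real.rpow_add hb]
      ring_nf
    rw [h1]
    have h2 := mul_le_mul_of_nonneg_right (ha' b hb.le h) (by positivity : 0 ≤ b ^ (-p))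
    linarith [(by positivity : 0 ≤ a ^ (-p'))]
  · exact (rpow_neg_le_of_le ha h hp').trans (le_add_of_nonneg_left (by positivity))

/-- The diagonal singularity dominates the one at the origin. -/
lemma tendsto_powKer_sub (hH : 0 < H) {p' : ℝ} (hp' : 0 ≤ p') (hp : 1 ≤ 2 * H * p) {θ T c D : ℝ}
    (hθ : 0 < θ) (hθT : θ ≤ T) (hc : 0 < c) (hD : 0 ≤ D) (hlt : D = 0 ∨ p' < p) :
    Tendsto (fun ε => c * (∫ r in (0 : ℝ)..θ, powKer H p ε r) -
      D * ∫ r in (0 : ℝ)..T, powKer H p' ε r) (𝓝[>] 0) atTop := by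
  have hlim := tendsto_integral_powKer hH hp hθ
  rcases hD.eq_or_lt with rfl | hD
  · simpa using hlim.const_mul_atTop hc
  have hlt := hlt.resolve_left hD.ne'
  have hp0 : 0 ≤ p := hp'.trans hlt.le
  -- This `ρ` makes the origin term consume half of the diagonal one; the part over `[θ, T]` is
  -- bounded.
  obtain ⟨E, hE, hEle⟩ := exists_powKer_le (H := H) hp' hlt (ρ := c / (2 * D)) (by positivity)
  have hlim2 : Tendsto (fun ε => c / 2 * (∫ r in (0 : ℝ)..θ, powKer H p ε r) +
      -(c / 2 * ((T - θ) * (θ ^ (2 * H)) ^ (-p)) + D * (T * E))) (𝓝[>] 0) atTop :=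
    tendsto_atTop_add_const_right _ _ (hlim.const_mul_atTop (by positivity))
  refine tendsto_atTop_mono' _ ?_ hlim2
  filter_upwards [self_mem_nhdsWithin] with ε hε
  have hε : 0 < ε := hε
  have hc1 := continuous_powKer (p := p) hH hε
  have hc2 := continuous_powKer (p := p') hH hε
  have hT : 0 ≤ T := hθ.le.trans hθT
  have h1 : ∫ r in (0 : ℝ)..T, powKer H p' ε r ≤
      c / (2 * D) * (∫ r in (0 : ℝ)..T, powKer H p ε r) + T * E := by
    have h := intervalIntegral.integral_mono_on (μ := volume) hT (hc2.intervalIntegrable 0 T)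
      (((hc1.const_mul (c / (2 * D))).add (continuous_const (y := E))).intervalIntegrable 0 T)
      fun r _ => hEle ε hε r
    simp only [Pi.add_apply] at h
    rwa [intervalIntegral.integral_add ((hc1.const_mul _).intervalIntegrable _ _)
      intervalIntegrable_const, intervalIntegral.integral_const_mul,
      intervalIntegral.integral_const, sub_zero, smul_eq_mul] at h
  have h2 : ∫ r in (0 : ℝ)..T, powKer H p ε r =
      (∫ r in (0 : ℝ)..θ, powKer H p ε r) + ∫ r in θ..T, powKer H p ε r :=
    (intervalIntegral.integral_add_adjacent_intervals (hc1.intervalIntegrable _ _)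
      (hc1.intervalIntegrable _ _)).symm
  have h3 : ∫ r in θ..T, powKer H p ε r ≤ (T - θ) * (θ ^ (2 * H)) ^ (-p) := by
    have h := intervalIntegral.integral_mono_on (μ := volume) hθT (hc1.intervalIntegrable θ T)
      intervalIntegrable_const (g := fun _ => (θ ^ (2 * H)) ^ (-p))
      fun r hr => by
        unfold powKer
        refine rpow_neg_le_of_le (by positivity) ?_ hp0
        have : θ ^ (2 * H) ≤ |r| ^ (2 * H) :=
          Real.rpow_le_rpow hθ.le (hr.1.trans (le_abs_self r)) (by positivity)
        linarith
    rwa [intervalIntegral.integral_const, smul_eq_mul] at h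
  have h4 := mul_le_mul_of_nonneg_left h1 hD.le
  have h5 : D * (c / (2 * D) * (∫ r in (0 : ℝ)..T, powKer H p ε r) + T * E) =
      c / 2 * (∫ r in (0 : ℝ)..T, powKer H p ε r) + D * (T * E) := by
    field_simp
  rw [h5, h2] at h4
  have h6 := mul_le_mul_of_nonneg_left h3 (by positivity : 0 ≤ c / 2)
  linarith

end PowerKernel

/-! ### Second moments of time integrals -/

section SecondMoment

variable {Ω : Type*} [MeasurableSpace Ω] {P : Measure Ω}

lemma integral_norm_sq_le_one {G : Ω → ℂ} (hG : MemLp G 2 P) (h : eLpNorm G 2 P ≤ 1) :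
    ∫ ω, ‖G ω‖ ^ 2 ∂P ≤ 1 := by
  rw [hG.eLpNorm_eq_integral_rpow_norm two_ne_zero ENNReal.ofNat_ne_top] at h
  simp only [ENNReal.toReal_ofNat, Real.rpow_two] at h
  rw [ENNReal.ofReal_le_one, Real.rpow_inv_le_iff_of_pos (integral_nonneg fun _ => by positivity)
    zero_le_one two_pos, Real.one_rpow] at h
  exact h

/-- An `L²` limit would keep the second moments bounded along small `ε`. -/
lemma DivergesInL2.of_tendsto {F : ℝ → Ω → ℂ} (hF : ∀ ε, 0 < ε → MemLp (F ε) 2 P)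
    (hlim : Tendsto (fun ε => ∫ ω, ‖F ε ω‖ ^ 2 ∂P) (𝓝[>] 0) atTop) : DivergesInL2 F P := by
  refine ⟨hF, ?_, hlim⟩
  rintro ⟨Y, hY, hconv⟩
  have h1 : ∀ᶠ ε in 𝓝[>] (0 : ℝ), eLpNorm (fun ω => F ε ω - Y ω) 2 P < 1 :=
    hconv.eventually_lt_const zero_lt_one
  obtain ⟨ε, ⟨h1, h2⟩, hε⟩ := ((h1.and (hlim.eventually_gt_atTop
    (2 * 1 + 2 * ∫ ω, ‖Y ω‖ ^ 2 ∂P))).and self_mem_nhdsWithin).exists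
  have hsub : MemLp (fun ω => F ε ω - Y ω) 2 P := (hF ε hε).sub hY
  have h3 := integral_norm_sq_le_one hsub h1.le
  have i1 : Integrable (fun ω => 2 * ‖F ε ω - Y ω‖ ^ 2) P :=
    ((memLp_two_iff_integrable_sq_norm hsub.1).1 hsub).const_mul 2
  have i2 : Integrable (fun ω => 2 * ‖Y ω‖ ^ 2) P :=
    ((memLp_two_iff_integrable_sq_norm hY.1).1 hY).const_mul 2
  have i3 := (memLp_two_iff_integrable_sq_norm (hF ε hε).1).1 (hF ε hε)
  have h4 : ∫ ω, ‖F ε ω‖ ^ 2 ∂P ≤ ∫ ω, (2 * ‖F ε ω - Y ω‖ ^ 2 + 2 * ‖Y ω‖ ^ 2) ∂P := by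
    refine integral_mono i3 (i1.add i2) fun ω => ?_
    have h5 := norm_add_le (F ε ω - Y ω) (Y ω)
    rw [sub_add_cancel] at h5
    simp only
    nlinarith [sq_nonneg (‖F ε ω - Y ω‖ - ‖Y ω‖), norm_nonneg (F ε ω)]
  rw [integral_add i1 i2, integral_const_mul, integral_const_mul] at h4
  linarith

variable {Z : ℝ → Ω → ℂ} {M T : ℝ}

lemma measurable_setIntegral (hZ : Measurable (Function.uncurry Z)) (S : Set ℝ) {w : ℝ → ℝ}
    (hw : Measurable w) : Measurable fun ω => ∫ t in S, (w t : ℂ) * Z t ω := by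
  have h : Measurable fun p : Ω × ℝ => (w p.2 : ℂ) * Z p.2 p.1 :=
    (Complex.measurable_ofReal.comp (hw.comp measurable_snd)).mul (hZ.comp measurable_swap)
  exact (h.stronglyMeasurable.integral_prod_right' (ν := volume.restrict S)).measurable

variable [IsProbabilityMeasure P]

lemma memLp_intervalIntegral (hZ : Measurable (Function.uncurry Z)) (hM : ∀ t ω, ‖Z t ω‖ ≤ M)
    (hT : 0 < T) : MemLp (fun ω => ∫ t in (0 : ℝ)..T, Z t ω) 2 P := by
  refine MemLp.of_bound (C := M * |T - 0|) ?_ (ae_of_all _ fun ω =>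
    intervalIntegral.norm_integral_le_of_norm_le_const fun t _ => hM t ω)
  have h := measurable_setIntegral hZ (Set.Ioc 0 T) (measurable_const (a := (1 : ℝ)))
  simp only [Complex.ofReal_one, one_mul] at h
  simp only [intervalIntegral.integral_of_le hT.le]
  exact h.aestronglyMeasurable

/-- A lower bound for the second moment of a time integral, by duality against its restriction to
`(T/2, T]`. -/
lemma le_integral_norm_sq (hZ : Measurable (Function.uncurry Z)) (hM : ∀ t ω, ‖Z t ω‖ ≤ M)
    (hT : 0 < T) {w : ℝ → ℝ} (hw : Measurable w) {N : ℝ} (hwN : ∀ s, |w s| ≤ N)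
    (hdual : ∀ ω, ((∫ t in Set.Ioc (T / 2) T, Z t ω) *
      conj (∫ s in Set.Ioc 0 T, (w s : ℂ) * Z s ω)).re ≤ ‖∫ t in (0 : ℝ)..T, Z t ω‖ ^ 2)
    {B : ℝ} (hB : ∀ t ∈ Set.Ioc (T / 2) T,
      B ≤ ∫ s in Set.Ioc 0 T, w s * (∫ ω, Z t ω * conj (Z s ω) ∂P).re) :
    T / 2 * B ≤ ∫ ω, ‖∫ t in (0 : ℝ)..T, Z t ω‖ ^ 2 ∂P := by
  set μ : Measure ℝ := volume.restrict (Set.Ioc (T / 2) T) with hμ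
  set ν : Measure ℝ := volume.restrict (Set.Ioc 0 T) with hν
  set f : Ω → ℝ × ℝ → ℂ := fun ω p => Z p.1 ω * conj ((w p.2 : ℂ) * Z p.2 ω) with hf
  have hfmeas : Measurable (Function.uncurry f) := by
    have hc : Measurable (conj : ℂ → ℂ) := Complex.continuous_conj.measurable
    have h1 : Measurable fun q : Ω × (ℝ × ℝ) => Z q.2.1 q.1 :=
      hZ.comp (measurable_snd.fst.prodMk measurable_fst)
    have h2 : Measurable fun q : Ω × (ℝ × ℝ) => Z q.2.2 q.1 :=
      hZ.comp (measurable_snd.snd.prodMk measurable_fst)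
    exact h1.mul (hc.comp ((Complex.measurable_ofReal.comp (hw.comp measurable_snd.snd)).mul h2))
  have hfint : Integrable (Function.uncurry f) (P.prod (μ.prod ν)) := by
    refine Integrable.of_bound hfmeas.aestronglyMeasurable (M * (N * M)) (ae_of_all _ fun q => ?_)
    have hM0 : 0 ≤ M := (norm_nonneg _).trans (hM q.2.1 q.1)
    have hN0 : 0 ≤ N := (abs_nonneg _).trans (hwN q.2.2)
    simp only [Function.uncurry, hf, norm_mul, RCLike.norm_conj, Complex.norm_real, Real.norm_eq_abs]
    have h1 := hM q.2.1 q.1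
    have h2 := hM q.2.2 q.1
    have h3 := hwN q.2.2
    gcongr
  have hprod : ∀ ω, (∫ t in Set.Ioc (T / 2) T, Z t ω) *
      conj (∫ s in Set.Ioc 0 T, (w s : ℂ) * Z s ω) = ∫ p, f ω p ∂(μ.prod ν) := by
    intro ω
    rw [← integral_conj]
    exact (integral_prod_mul (fun t => Z t ω) (fun s => conj ((w s : ℂ) * Z s ω))).symm
  have hint1 : Integrable (fun ω => ∫ p, f ω p ∂(μ.prod ν)) P := hfint.integral_prod_left
  have h1 : (∫ ω, ∫ p, f ω p ∂(μ.prod ν) ∂P).re ≤ ∫ ω, ‖∫ t in (0 : ℝ)..T, Z t ω‖ ^ 2 ∂P := by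
    have h2 := integral_re hint1
    simp only [RCLike.re_to_complex] at h2
    rw [← h2]
    have hL := memLp_intervalIntegral (P := P) hZ hM hT
    refine integral_mono hint1.re ((memLp_two_iff_integrable_sq_norm hL.1).1 hL) fun ω => ?_
    simp only [← hprod]
    exact hdual ω
  refine le_trans ?_ h1
  have hswap : ∫ ω, ∫ p, f ω p ∂(μ.prod ν) ∂P = ∫ p, ∫ ω, f ω p ∂P ∂(μ.prod ν) :=
    integral_integral_swap hfint
  have hint2 : Integrable (fun p => ∫ ω, f ω p ∂P) (μ.prod ν) := hfint.integral_prod_right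
  have hre := integral_re hint2
  simp only [RCLike.re_to_complex] at hre
  have hint3 : Integrable (fun p => (∫ ω, f ω p ∂P).re) (μ.prod ν) := hint2.re
  have hfe : ∀ p : ℝ × ℝ, (∫ ω, f ω p ∂P).re =
      w p.2 * (∫ ω, Z p.1 ω * conj (Z p.2 ω) ∂P).re := by
    intro p
    have h3 : ∀ ω, f ω p = (w p.2 : ℂ) * (Z p.1 ω * conj (Z p.2 ω)) := by
      intro ω
      simp only [hf, map_mul, Complex.conj_ofReal]
      ring
    simp only [h3]
    rw [integral_const_mul, Complex.re_ofReal_mul]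
  rw [hswap, ← hre, integral_prod _ hint3]
  have hconst : T / 2 * B = ∫ _t in Set.Ioc (T / 2) T, B := by
    rw [setIntegral_const, smul_eq_mul, Real.volume_real_Ioc_of_le (by linarith)]
    ring
  rw [hconst]
  refine setIntegral_mono_on (integrableOn_const (by simp)) hint3.integral_prod_left
    measurableSet_Ioc fun t ht => ?_
  simp only [hfe]
  exact hB t ht

end SecondMoment

/-! ### Covariances of the multidimensional kernel -/

section GaussianField

variable {Ω : Type*} [MeasurableSpace Ω] {P : Measure Ω} {d : ℕ}
  {X : ℝ≥0 → Ω → EuclideanSpace ℝ (Fin d)} {H : ℝ}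

lemma measurable_component (hX : Measurable (fun p : ℝ≥0 × Ω => X p.1 p.2)) (ℓ : Fin d)
    (t : ℝ≥0) : Measurable (component X ℓ t) := by
  have h : Measurable (X t) := hX.comp measurable_prodMk_left
  unfold component
  fun_prop

lemma cov_component_eq (hX : ClassGS X H P) (ℓ ℓ' : Fin d) :
    cov (component X ℓ) P = cov (component X ℓ') P := by
  ext t s
  have h : Measurable fun f : ℝ≥0 → ℝ => f t * f s := by fun_prop
  exact ((hX.identDistrib ℓ ℓ').comp h).integral_eq

lemma integral_fracDerivHeatKernel_mul_conj [IsProbabilityMeasure P]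
    (hXm : Measurable (fun p : ℝ≥0 × Ω => X p.1 p.2)) (hX : ClassGS X H P) (σ : ℝ)
    {α : Fin d → ℝ} (hα : ∀ ℓ, 0 ≤ α ℓ) (x : EuclideanSpace ℝ (Fin d)) {ε : ℝ} (hε : 0 < ε)
    (ℓ₀ : Fin d) (t s : ℝ≥0) :
    ∫ ω, fracDerivHeatKernel σ α ε (X t ω + x) * conj (fracDerivHeatKernel σ α ε (X s ω + x)) ∂P =
      prodQuad σ α x (cov (component X ℓ₀) P t t + ε) (cov (component X ℓ₀) P s s + ε)
        (cov (component X ℓ₀) P t s) := by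
  have hc : Measurable (conj : ℂ → ℂ) := Complex.continuous_conj.measurable
  have hg : ∀ ℓ, Measurable (fracHeat σ (α ℓ) ε) := fun ℓ =>
    (continuous_fracHeat σ (hα ℓ) hε).measurable
  set g : ∀ _ : Fin d, (ℝ≥0 → ℝ) → ℂ := fun ℓ f =>
    fracHeat σ (α ℓ) ε (f t + x ℓ) * conj (fracHeat σ (α ℓ) ε (f s + x ℓ)) with hgdef
  have hgm : ∀ ℓ, Measurable (g ℓ) := by
    intro ℓ
    have h1 := hg ℓ
    simp only [hgdef]
    fun_prop
  have hind := hX.indep.comp g hgm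
  have hpt : ∀ ω, fracDerivHeatKernel σ α ε (X t ω + x) *
      conj (fracDerivHeatKernel σ α ε (X s ω + x)) =
      ∏ ℓ, (g ℓ ∘ fun ω t => component X ℓ t ω) ω := by
    intro ω
    simp only [fracDerivHeatKernel_eq_prod, map_prod, ← Finset.prod_mul_distrib]
    rfl
  simp only [hpt]
  rw [hind.integral_fun_prod_eq_prod_integral fun ℓ => ?_, prodQuad]
  · refine Finset.prod_congr rfl fun ℓ _ => ?_
    rw [cov_component_eq hX ℓ₀ ℓ]
    exact integral_fracHeat_mul_conj (hα ℓ) hε (x ℓ) (measurable_component hXm ℓ t).aemeasurable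
      (measurable_component hXm ℓ s).aemeasurable
      (integral_cexp_linear (hX.gaussian ℓ) (hX.centered ℓ) t s)
  · have h : Measurable fun ω (t : ℝ≥0) => component X ℓ t ω :=
      measurable_pi_lambda _ fun t => measurable_component hXm ℓ t
    exact ((hgm ℓ).comp h).aestronglyMeasurable

lemma IncrementCovarianceDecay.covDecay {Y : ℝ≥0 → Ω → ℝ} (hY : IsGaussianProcess Y P)
    (h : IncrementCovarianceDecay Y P) : CovDecay (cov Y P) := by
  obtain ⟨β, -, -, hβ, h⟩ := h
  refine ⟨β, hβ, fun s t γ hs hst hγ hle => ?_⟩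
  have h1 := h s t γ hs hst hγ hle
  rwa [integral_sub_mul hY, integral_sq_sub hY, integral_sq_eq_cov] at h1

end GaussianField

/-! ### Regularity and positivity of the kernel -/

section Kernel

variable {d : ℕ} {α : Fin d → ℝ} {σ ε : ℝ}

lemma continuous_fracDerivHeatKernel (hα : ∀ ℓ, 0 ≤ α ℓ) (hε : 0 < ε) :
    Continuous (fracDerivHeatKernel σ α ε) := by
  simp only [funext (fracDerivHeatKernel_eq_prod σ α ε)]
  have h := fun ℓ => continuous_fracHeat σ (hα ℓ) hε
  fun_prop

lemma exists_norm_fracDerivHeatKernel_le (σ : ℝ) (α : Fin d → ℝ) (ε : ℝ) :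
    ∃ M : ℝ, ∀ v, ‖fracDerivHeatKernel σ α ε v‖ ≤ M := by
  choose M hM using fun ℓ => exists_norm_fracHeat_le σ (α ℓ) ε
  refine ⟨∏ ℓ, M ℓ, fun v => ?_⟩
  rw [fracDerivHeatKernel_eq_prod, norm_prod]
  exact Finset.prod_le_prod (fun _ _ => norm_nonneg _) fun ℓ _ => hM ℓ _

lemma fracDerivHeatKernel_of_order_zero (hα : ∀ ℓ, α ℓ = 0) (hε : 0 < ε)
    (v : EuclideanSpace ℝ (Fin d)) : ∃ r : ℝ, 0 ≤ r ∧ fracDerivHeatKernel σ α ε v = r := by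
  choose r hr hr' using fun ℓ => fracHeat_zero_order σ hε (v ℓ)
  refine ⟨∏ ℓ, r ℓ, Finset.prod_nonneg fun ℓ _ => (hr ℓ).le, ?_⟩
  simp only [fracDerivHeatKernel_eq_prod, hα, hr', Complex.ofReal_prod]

end Kernel

/-! ### Duality weights and conclusion -/

/-- The bound `Re (v conj (v + 2 u)) ≤ |u + v|²`. -/
lemma re_mul_conj_le (u v : ℂ) : (v * conj (v + 2 * u)).re ≤ ‖u + v‖ ^ 2 := by
  rw [← Complex.normSq_eq_norm_sq, Complex.normSq_apply]
  simp only [Complex.mul_re, Complex.conj_re, Complex.conj_im, Complex.add_re, Complex.add_im,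
    Complex.mul_im, Complex.re_ofNat, Complex.im_ofNat]
  nlinarith [sq_nonneg u.re, sq_nonneg u.im]

/-- Weight two on the first half and one on the second integrates to `v + 2u`; what is discarded
from `|u + v|²` is exactly `|u|²`. -/
lemma re_mul_conj_dual_weight_le {Z : ℝ → ℂ} {T : ℝ} (hT : 0 < T)
    (hZ : IntegrableOn Z (Set.Ioc 0 T)) :
    ((∫ t in Set.Ioc (T / 2) T, Z t) *
      conj (∫ s in Set.Ioc 0 T, (((if s ≤ T / 2 then 2 else 1 : ℝ)) : ℂ) * Z s)).re ≤
      ‖∫ t in (0 : ℝ)..T, Z t‖ ^ 2 := by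
  have hdisj : Disjoint (Set.Ioc 0 (T / 2)) (Set.Ioc (T / 2) T) := Set.Ioc_disjoint_Ioc_of_le le_rfl
  have hun : Set.Ioc 0 T = Set.Ioc 0 (T / 2) ∪ Set.Ioc (T / 2) T :=
    (Set.Ioc_union_Ioc_eq_Ioc (by linarith) (by linarith)).symm
  have h1 : IntegrableOn Z (Set.Ioc 0 (T / 2)) := hZ.mono_set (by rw [hun]; exact Set.subset_union_left)
  have h2 : IntegrableOn Z (Set.Ioc (T / 2) T) := hZ.mono_set (by rw [hun]; exact Set.subset_union_right)
  have e1 : Set.EqOn (fun s => (((if s ≤ T / 2 then 2 else 1 : ℝ)) : ℂ) * Z s) (fun s => 2 * Z s)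
      (Set.Ioc 0 (T / 2)) := by
    intro s hs
    simp [hs.2]
  have e2 : Set.EqOn (fun s => (((if s ≤ T / 2 then 2 else 1 : ℝ)) : ℂ) * Z s) Z
      (Set.Ioc (T / 2) T) := by
    intro s hs
    simp [not_le.2 hs.1]
  rw [intervalIntegral.integral_of_le hT.le, hun, setIntegral_union hdisj measurableSet_Ioc h1 h2,
    setIntegral_union hdisj measurableSet_Ioc
      ((integrableOn_congr_fun e1 measurableSet_Ioc).2 (h1.const_mul 2))
      ((integrableOn_congr_fun e2 measurableSet_Ioc).2 h2),
    setIntegral_congr_fun measurableSet_Ioc e1, setIntegral_congr_fun measurableSet_Ioc e2,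
    integral_const_mul, add_comm (2 * _)]
  exact re_mul_conj_le _ _

lemma re_mul_conj_le_of_nonneg {Z : ℝ → ℂ} {T : ℝ} (hT : 0 < T)
    (hZ : IntegrableOn Z (Set.Ioc 0 T)) (hpos : ∀ t, ∃ r : ℝ, 0 ≤ r ∧ Z t = r) :
    ((∫ t in Set.Ioc (T / 2) T, Z t) * conj (∫ s in Set.Ioc 0 T, ((1 : ℝ) : ℂ) * Z s)).re ≤
      ‖∫ t in (0 : ℝ)..T, Z t‖ ^ 2 := by
  choose r hr hr' using hpos
  obtain rfl : Z = fun t => (r t : ℂ) := funext hr'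
  have hri : IntegrableOn r (Set.Ioc 0 T) := hZ.re
  simp only [Complex.ofReal_one, one_mul]
  rw [intervalIntegral.integral_of_le hT.le, integral_complex_ofReal, integral_complex_ofReal,
    Complex.conj_ofReal, ← Complex.ofReal_mul, Complex.ofReal_re, Complex.norm_real,
    Real.norm_eq_abs, sq_abs, sq]
  refine mul_le_mul_of_nonneg_right ?_ (integral_nonneg hr)
  exact setIntegral_mono_set hri (ae_of_all _ hr)
    (LE.le.eventuallyLE (Set.Ioc_subset_Ioc_left (by linarith)))

/-- Integration in `s` of the near-diagonal and off-diagonal lower bounds. -/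
lemma le_setIntegral_of_near_far {H p p' ε θ T c D N t : ℝ} (hH : 0 < H) (hε : 0 < ε)
    (hθ : 0 < θ) (hθT : θ ≤ T / 2) (hT : 0 < T) (ht : t ∈ Set.Ioc (T / 2) T) (hc : 0 ≤ c)
    (hD : 0 ≤ D) {F : ℝ → ℝ} (hF : Measurable F) (hFN : ∀ s, |F s| ≤ N)
    (hnear : ∀ s ∈ Set.Ioc 0 T, |t - s| ≤ θ → c * powKer H p ε (t - s) ≤ F s)
    (hfar : ∀ s ∈ Set.Ioc 0 T, θ ≤ |t - s| → -(D * powKer H p' ε s) ≤ F s) :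
    c * (∫ r in (0 : ℝ)..θ, powKer H p ε r) - D * (∫ r in (0 : ℝ)..T, powKer H p' ε r) ≤
      ∫ s in Set.Ioc 0 T, F s := by
  have hc1 := continuous_powKer (p := p) hH hε
  have hc2 := continuous_powKer (p := p') hH hε
  -- Only the left side of the diagonal is kept, as it stays inside `(0, T]` for every `t > T / 2`.
  have hsub : Set.Ioc (t - θ) t ⊆ Set.Ioc 0 T := fun s hs =>
    ⟨by linarith [hs.1, ht.1], hs.2.trans ht.2⟩
  have hcs : Continuous fun s => c * powKer H p ε (t - s) :=
    continuous_const.mul (hc1.comp (continuous_const.sub continuous_id))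
  have i1 : IntegrableOn ((Set.Ioc (t - θ) t).indicator fun s => c * powKer H p ε (t - s))
      (Set.Ioc 0 T) :=
    (hcs.integrableOn_Ioc).indicator measurableSet_Ioc
  have i2 : IntegrableOn (fun s => D * powKer H p' ε s) (Set.Ioc 0 T) :=
    (hc2.const_mul D).integrableOn_Ioc
  have i3 : IntegrableOn F (Set.Ioc 0 T) :=
    Integrable.of_bound hF.aestronglyMeasurable N (ae_of_all _ hFN)
  have h1 : ∫ s in Set.Ioc 0 T, (Set.Ioc (t - θ) t).indicator
      (fun s => c * powKer H p ε (t - s)) s = c * ∫ r in (0 : ℝ)..θ, powKer H p ε r := by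
    rw [setIntegral_indicator measurableSet_Ioc, Set.inter_eq_self_of_subset_right hsub,
      ← intervalIntegral.integral_of_le (by linarith), intervalIntegral.integral_const_mul,
      intervalIntegral.integral_comp_sub_left (fun r => powKer H p ε r) t]
    simp
  have h2 : ∫ s in Set.Ioc 0 T, D * powKer H p' ε s = D * ∫ r in (0 : ℝ)..T, powKer H p' ε r := by
    rw [← intervalIntegral.integral_of_le hT.le, intervalIntegral.integral_const_mul]
  rw [← h1, ← h2, ← integral_sub i1 i2]
  refine setIntegral_mono_on (i1.sub i2) i3 measurableSet_Ioc fun s hs => ?_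
  have hD' : 0 ≤ D * powKer H p' ε s := mul_nonneg hD (powKer_nonneg hε s)
  have hc' : 0 ≤ c * powKer H p ε (t - s) := mul_nonneg hc (powKer_nonneg hε _)
  have hind : (Set.Ioc (t - θ) t).indicator (fun s => c * powKer H p ε (t - s)) s ≤
      c * powKer H p ε (t - s) := Set.indicator_le_self' (fun _ _ => hc') s
  rcases le_or_gt |t - s| θ with h | h
  · linarith [hnear s hs h]
  · have : s ∉ Set.Ioc (t - θ) t := fun h' => by
      rw [abs_of_nonneg (by linarith [h'.2])] at h
      linarith [h'.1]
    rw [Set.indicator_of_notMem this]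
    linarith [hfar s hs h.le]

/-- The second moments of the approximations diverge: neither the sign of the covariances nor the
parity of the orders matters at `x = 0`. -/
theorem divergesInL2_approxDeriv {Ω : Type*} [MeasurableSpace Ω] {P : Measure Ω}
    [IsProbabilityMeasure P] {d : ℕ} {H : ℝ} (hH0 : 0 < H)
    {X : ℝ≥0 → Ω → EuclideanSpace ℝ (Fin d)}
    (hXmeas : Measurable (fun p : ℝ≥0 × Ω => X p.1 p.2)) (hX : ClassGSU X H P)
    {T : ℝ} (hT : 0 < T) (α : Fin d → ℝ) (hα : ∀ ℓ, 0 ≤ α ℓ)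
    (hcrit : 1 ≤ H * (2 * (∑ ℓ, α ℓ) + (d : ℝ))) (σ : ℝ) (x : EuclideanSpace ℝ (Fin d))
    (hx : x = 0 ∨ ∀ ℓ, IncrementCovarianceDecay (component X ℓ) P) :
    DivergesInL2 (approxDeriv X σ α T x) P := by
  have hd : d ≠ 0 := by
    rintro rfl
    simp at hcrit
    linarith
  have ℓ₀ : Fin d := ⟨0, Nat.pos_of_ne_zero hd⟩
  obtain ⟨κ, K, hκ, hK, hR⟩ := exists_covBounds (hX.gaussian ℓ₀)
    (measurable_component hXmeas ℓ₀) (hX.slnd ℓ₀) (hX.increment_le ℓ₀)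
  have hx' : (∀ ℓ, x ℓ = 0) ∨ CovDecay (cov (component X ℓ₀) P) := by
    rcases hx with rfl | hx
    · exact Or.inl fun ℓ => rfl
    · exact Or.inr ((hx ℓ₀).covDecay (hX.gaussian ℓ₀))
  obtain ⟨θ, ε₀, c, hθ, hθT, hε₀, hc, hnear⟩ :=
    hR.exists_le_re_prodQuad hκ hK hH0 hT hα σ x hx'
  obtain ⟨D, hD, hfar⟩ := hR.exists_norm_prodQuad_le hκ hK hH0 hT hθ hα σ x
  set R := cov (component X ℓ₀) P with hRdef
  have hsum : 0 ≤ ∑ ℓ, α ℓ := Finset.sum_nonneg fun ℓ _ => hα ℓ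
  set Z : ℝ → ℝ → Ω → ℂ := fun ε t ω => fracDerivHeatKernel σ α ε (X t.toNNReal ω + x) with hZdef
  have hZm : ∀ ε, 0 < ε → Measurable (Function.uncurry (Z ε)) := by
    intro ε hε
    have h1 := (continuous_fracDerivHeatKernel (σ := σ) hα hε).measurable
    have h2 : Measurable fun q : ℝ × Ω => X q.1.toNNReal q.2 :=
      hXmeas.comp ((measurable_real_toNNReal.comp measurable_fst).prodMk measurable_snd)
    exact h1.comp (h2.add_const x)
  have hcov : ∀ ε, 0 < ε → ∀ t s : ℝ, ∫ ω, Z ε t ω * conj (Z ε s ω) ∂P =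
      prodQuad σ α x (R t.toNNReal t.toNNReal + ε) (R s.toNNReal s.toNNReal + ε)
        (R t.toNNReal s.toNNReal) := fun ε hε t s =>
    integral_fracDerivHeatKernel_mul_conj hXmeas hX.toClassGS σ hα x hε ℓ₀ _ _
  refine DivergesInL2.of_tendsto (fun ε hε => ?_) ?_
  · obtain ⟨M, hM⟩ := exists_norm_fracDerivHeatKernel_le σ α ε
    exact memLp_intervalIntegral (hZm ε hε) (fun t ω => hM _) hT
  set p := ∑ ℓ, α ℓ + (d : ℝ) / 2 with hp
  set p' := (∑ ℓ, α ℓ + (d : ℝ)) / 2 with hp'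
  obtain ⟨w, E, hw, hw1, hw2, hE, hEp, hdual, hfarE⟩ : ∃ (w : ℝ → ℝ) (E : ℝ), Measurable w ∧
      (∀ s, 1 ≤ w s) ∧ (∀ s, w s ≤ 2) ∧ 0 ≤ E ∧ (E = 0 ∨ p' < p) ∧
      (∀ ε, 0 < ε → ∀ ω, ((∫ t in Set.Ioc (T / 2) T, Z ε t ω) *
        conj (∫ s in Set.Ioc 0 T, (w s : ℂ) * Z ε s ω)).re ≤ ‖∫ t in (0 : ℝ)..T, Z ε t ω‖ ^ 2) ∧
      ∀ ε, 0 < ε → ∀ t ∈ Set.Ioc (T / 2) T, ∀ s ∈ Set.Ioc 0 T, θ ≤ |t - s| →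
        -(E * powKer H p' ε s) ≤ w s * (∫ ω, Z ε t ω * conj (Z ε s ω) ∂P).re := by
    have hZi : ∀ ε, 0 < ε → ∀ ω, IntegrableOn (fun t => Z ε t ω) (Set.Ioc 0 T) := by
      intro ε hε ω
      obtain ⟨M, hM⟩ := exists_norm_fracDerivHeatKernel_le σ α ε
      exact Integrable.of_bound ((hZm ε hε).comp measurable_prodMk_right).aestronglyMeasurable M
        (ae_of_all _ fun t => hM _)
    -- Since `p - p' = |α| / 2`, domination fails at `|α| = 0`. There the kernel is nonnegative, so
    -- the weight one suffices and no error term arises.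
    rcases hsum.eq_or_lt with h0 | hpos
    · have hα0 : ∀ ℓ, α ℓ = 0 := fun ℓ =>
        (Finset.sum_eq_zero_iff_of_nonneg fun ℓ _ => hα ℓ).1 h0.symm ℓ (Finset.mem_univ ℓ)
      refine ⟨fun _ => 1, 0, measurable_const, fun _ => le_rfl, fun _ => one_le_two, le_rfl,
        Or.inl rfl, fun ε hε ω => ?_, fun ε hε t _ s _ _ => ?_⟩
      · exact re_mul_conj_le_of_nonneg hT (hZi ε hε ω) fun t =>
          fracDerivHeatKernel_of_order_zero hα0 hε _
      · choose r hr hr' using fun t ω =>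
          fracDerivHeatKernel_of_order_zero (σ := σ) hα0 hε (X (Real.toNNReal t) ω + x)
        have h1 : ∀ ω, Z ε t ω * conj (Z ε s ω) = ((r t ω * r s ω : ℝ) : ℂ) := by
          intro ω
          simp only [hZdef, hr', Complex.conj_ofReal, Complex.ofReal_mul]
        simp only [h1]
        rw [integral_complex_ofReal, Complex.ofReal_re, zero_mul, neg_zero, one_mul]
        exact integral_nonneg fun ω => mul_nonneg (hr t ω) (hr s ω)
    · refine ⟨fun s => if s ≤ T / 2 then 2 else 1, 2 * D,
        Measurable.ite measurableSet_Iic measurable_const measurable_const,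
        fun s => by dsimp only; split_ifs <;> norm_num,
        fun s => by dsimp only; split_ifs <;> norm_num, by positivity,
        Or.inr (by simp only [hp, hp']; linarith), fun ε hε ω => ?_, fun ε hε t ht s hs hts => ?_⟩
      · exact re_mul_conj_dual_weight_le hT (hZi ε hε ω)
      · have ht0 : 0 ≤ t := by linarith [ht.1]
        have h1 := hfar t.toNNReal s.toNNReal ε (by rw [Real.coe_toNNReal _ ht0]; exact ht.1.le)
          (by rw [Real.coe_toNNReal _ ht0]; exact ht.2) (Real.toNNReal_pos.2 hs.1)
          (by rw [Real.coe_toNNReal _ hs.1.le]; exact hs.2)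
          (by rwa [Real.coe_toNNReal _ ht0, Real.coe_toNNReal _ hs.1.le]) hε
        rw [← hcov ε hε, Real.coe_toNNReal _ hs.1.le] at h1
        have h2 : powKer H p' ε s = (s ^ (2 * H) + ε) ^ (-p') := by
          rw [powKer, abs_of_pos hs.1]
        rw [← h2] at h1
        have h3 := (abs_le.1 ((Complex.abs_re_le_norm _).trans h1)).1
        have h4 : 0 ≤ D * powKer H p' ε s := mul_nonneg hD (powKer_nonneg hε s)
        simp only
        split_ifs <;> linarith
  have hlim := tendsto_powKer_sub (T := T) hH0 (p := p) (p' := p') (by positivity)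
    (by simp only [hp]; linarith) hθ (by linarith) hc hE hEp
  refine tendsto_atTop_mono' _ ?_ (hlim.const_mul_atTop (half_pos hT))
  filter_upwards [self_mem_nhdsWithin, mem_nhdsWithin_of_mem_nhds (Iic_mem_nhds hε₀)]
    with ε hε hεε₀
  have hε : 0 < ε := hε
  obtain ⟨M, hM⟩ := exists_norm_fracDerivHeatKernel_le σ α ε
  refine le_integral_norm_sq (hZm ε hε) (fun t ω => hM _) hT hw (N := 2)
    (fun s => abs_le.2 ⟨by linarith [hw1 s], hw2 s⟩) (hdual ε hε) fun t ht => ?_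
  have ht0 : 0 ≤ t := by linarith [ht.1]
  have hM0 : 0 ≤ M := (norm_nonneg _).trans (hM 0)
  have hFm : Measurable fun s => (∫ ω, Z ε t ω * conj (Z ε s ω) ∂P).re := by
    have h1 : Measurable fun q : ℝ × Ω => Z ε t q.2 * conj (Z ε q.1 q.2) :=
      ((hZm ε hε).comp (measurable_const.prodMk measurable_snd)).mul
        (Complex.continuous_conj.measurable.comp (hZm ε hε))
    exact Complex.measurable_re.comp (h1.stronglyMeasurable.integral_prod_right').measurable
  refine le_setIntegral_of_near_far (N := 2 * (M * M)) hH0 hε hθ (by linarith) hT ht hc.le hE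
    (hw.mul hFm) (fun s => ?_) (fun s hs hts => ?_) (fun s hs hts => hfarE ε hε t ht s hs hts)
  · have h1 : ‖∫ ω, Z ε t ω * conj (Z ε s ω) ∂P‖ ≤ M * M := by
      have := norm_integral_le_of_norm_le_const (μ := P) (C := M * M)
        (ae_of_all _ fun ω => (by
          rw [norm_mul, RCLike.norm_conj]
          exact mul_le_mul (hM _) (hM _) (norm_nonneg _) hM0 :
          ‖Z ε t ω * conj (Z ε s ω)‖ ≤ M * M))
      simpa using this
    rw [abs_mul, abs_of_nonneg (by linarith [hw1 s])]
    exact mul_le_mul (hw2 s) ((Complex.abs_re_le_norm _).trans h1) (abs_nonneg _) zero_le_two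
  · have h1 := hnear t.toNNReal s.toNNReal ε (by rw [Real.coe_toNNReal _ ht0]; exact ht.1.le)
      (by rw [Real.coe_toNNReal _ ht0]; exact ht.2) (Real.toNNReal_pos.2 hs.1)
      (by rw [Real.coe_toNNReal _ hs.1.le]; exact hs.2)
      (by rwa [Real.coe_toNNReal _ ht0, Real.coe_toNNReal _ hs.1.le]) hε hεε₀
    rw [← hcov ε hε, Real.coe_toNNReal _ hs.1.le, Real.coe_toNNReal _ ht0] at h1
    have h2 : 0 ≤ c * powKer H p ε (t - s) := mul_nonneg hc.le (powKer_nonneg hε _)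
    refine h1.trans ?_
    exact le_mul_of_one_le_left (h2.trans h1) (hw1 s)

end FracLocalTime

end

theorem theorem1p2 {Ω : Type*} [MeasurableSpace Ω] {P : Measure Ω} [IsProbabilityMeasure P]
    {d : ℕ} {H : ℝ} (hH0 : 0 < H) (hH1 : H < 1)
    {X : ℝ≥0 → Ω → EuclideanSpace ℝ (Fin d)}
    (hXmeas : Measurable (fun p : ℝ≥0 × Ω => X p.1 p.2))
    (hX : FracLocalTime.ClassGSU X H P)
    {T : ℝ} (hT : 0 < T) (α : Fin d → ℝ) (hα : ∀ ℓ, 0 ≤ α ℓ)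
    (hcrit : 1 ≤ H * (2 * (∑ ℓ, α ℓ) + (d : ℝ)))
    {σ : ℝ} (hσ : σ = 1 ∨ σ = -1) :
    (H * (d : ℝ) ≤ 1 →
      FracLocalTime.DivergesInL2 (FracLocalTime.approxDeriv X σ α T 0) P) ∧
    (1 < H * (d : ℝ) → Even (FracLocalTime.integerOrderSum α) →
      FracLocalTime.DivergesInL2 (FracLocalTime.approxDeriv X σ α T 0) P) ∧
    (1 < H * (d : ℝ) → Odd (FracLocalTime.integerOrderSum α) →
      FracLocalTime.ClassGSUHat X H P →
      FracLocalTime.DivergesInL2 (FracLocalTime.approxDeriv X σ α T 0) P) ∧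
    (∀ x : EuclideanSpace ℝ (Fin d), (∃ ℓ, FracLocalTime.IsInt (α ℓ) ∧ x ℓ ≠ 0) →
      FracLocalTime.ClassGSUTilde X H P →
      FracLocalTime.DivergesInL2 (FracLocalTime.approxDeriv X σ α T x) P) := by
  have key := fun x hx => FracLocalTime.divergesInL2_approxDeriv hH0 hXmeas hX hT α hα hcrit σ x hx
  exact ⟨fun _ => key 0 (Or.inl rfl), fun _ _ => key 0 (Or.inl rfl),
    fun _ _ _ => key 0 (Or.inl rfl), fun x _ hX' => key x (Or.inr hX'.decay)⟩
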